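/- Fix $N\ge 1$. A *colored $N$-space* is a graph whose vertex set is partitioned into levels $\mathcal A_0,\dots,\mathcal A_N$ such that a vertex of $\mathcal A_i$ can only be linked to vertices of $\mathcal A_{i-1}\cup\mathcal A_{i+1}$; it is viewed as a structure in the language with one binary relation symbol for the edges and unary predicates for the levels. Two imaginary vertices are added: $a_{-1}$, of level $-1$, linked to all vertices of $\mathcal A_0$, and $a_{N+1}$, of level $N+1$, linked to all vertices of $\mathcal A_N$. For vertices $a$ of level $l$ and $b$ of level $r$ with $l<r$, $a$ *lies beneath* $b$ (and $b$ *lies over* $a$) if there is a path $a=a_l,a_{l+1},\dots,a_r=b$ with each $a_k$ of level $k$; by convention $a_{-1}$ lies beneath, and $a_{N+1}$ lies over, all other vertices. A vertex *lies between* $a$ and $b$ if it lies over $a$ and beneath $b$. For an interval $t$ of levels, $\mathcal A_t$ is the subgraph of the vertices with level in $t$. The theory $PS_N$ consists of the axioms of colored $N$-spaces together with the following first-order axiom schemes. 1. (Simple connectedness) For all $-1\le l<r\le N+1$, all non-empty intervals $t\subseteq[l,r]$ and all $k\ge 0$: if $a\in\mathcal A_l$ lies beneath $b\in\mathcal A_r$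 and $x,y\in\mathcal A_t$ lie between $a$ and $b$ and are connected by a path of length $k$ in $\mathcal A_t$ passing through neither $a$ nor $b$, then $x$ and $y$ are connected by a path of length at most $k$ in $\mathcal A_t$ all of whose vertices lie between $a$ and $b$. 2. (Extension) For all non-empty open intervals $s=(l,r)$ with $-1\le l<r\le N+1$ (that is, $r\ge l+2$), and all $n,k\ge 0$: for every set $A$ of at most $n$ vertices and all $a_l\in\mathcal A_l$ and $a_r\in\mathcal A_r$ with $a_l$ beneath $a_r$, there is a path $a_l,b_{l+1},\dots,b_{r-1},a_r$ with $b_i\in\mathcal A_i$ such that for each $i\in s$ the distance in $\mathcal A_s$ from $b_i$ to every element of $A\cap\mathcal A_s$ is greater than $k$ (it is infinite if they are not connected in $\mathcal A_s$). **Proposition.** For every $N\ge1$ the theory $PS_N$ is $\omega$-stable: for every model $M$ of $PS_N$, every countable set $A\subseteq M$ and every $n$, there are only countably many complete $n$-types over $A$. -/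

import Mathlib

open FirstOrder

universe u v w

/-- A first-order theory `T` is `ω`-stable if for every model `M` of `T`, every countable set
`A ⊆ M` of parameters and every `n`, there are only countably many complete `n`-types over `A`,
that is, complete types in `n` variables over the theory of `M` with the elements of `A` named. -/
def FirstOrder.Language.Theory.IsOmegaStable {L : FirstOrder.Language.{u, v}}
    (T : L.Theory) : Prop :=
  ∀ (M : Type w) [L.Structure M] [Nonempty M], M ⊨ T → ∀ A : Set M, A.Countable →
    ∀ n : ℕ, Countable ((L[[A]].completeTheory M).CompleteType (Fin n))

namespace Pseudospace

open FirstOrder.Language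

/-- The relation symbols for colored `N`-spaces: the levels `𝒜₀, …, 𝒜_N` and the edge relation. -/
inductive Rel (N : ℕ) : ℕ → Type
  | level (i : Fin (N + 1)) : Rel N 1
  | edge : Rel N 2

/-- The language of colored `N`-spaces. -/
protected def language (N : ℕ) : FirstOrder.Language.{0, 0} := ⟨fun _ => Empty, Rel N⟩

/-- The unary relation symbol for the level `𝒜ᵢ`. -/
def levelSymbol {N : ℕ} (i : Fin (N + 1)) : (Pseudospace.language N).Relations 1 := Rel.level i

/-- The binary relation symbol for edges. -/
def edgeSymbol (N : ℕ) : (Pseudospace.language N).Relations 2 := Rel.edge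

/-- A vertex expression over the variables `α`: a variable, standing for an actual vertex, or one
of the two imaginary vertices `bot = a₋₁` (of level `-1`) and `top = a_{N+1}` (of level `N + 1`). -/
inductive Vertex (α : Type) : Type
  | bot : Vertex α
  | var (x : α) : Vertex α
  | top : Vertex α

/-- Renaming of variables in a vertex expression. -/
def Vertex.map {α β : Type} (f : α → β) : Vertex α → Vertex β
  | .bot => .bot
  | .var x => .var (f x)
  | .top => .top

section Formulas

variable (N : ℕ)

/-- The formula `x = y`. -/
def eqF {α : Type} (x y : α) : (Pseudospace.language N).Formula α :=
  Term.equal (Term.var x) (Term.var y)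

/-- `x ∈ 𝒜ᵢ`. The level `-1` consists of `bot` only, the level `N + 1` of `top` only. -/
def levelF {α : Type} (i : ℤ) : Vertex α → (Pseudospace.language N).Formula α
  | .bot => if i = -1 then ⊤ else ⊥
  | .var x =>
    if h : 0 ≤ i ∧ i ≤ N then
      (levelSymbol ⟨i.toNat, by omega⟩).formula₁ (Term.var x)
    else ⊥
  | .top => if i = N + 1 then ⊤ else ⊥

/-- `x` and `y` are linked; `bot` is linked exactly to the vertices of level `0` and `top` exactly
to those of level `N`. -/
def edgeF {α : Type} : Vertex α → Vertex α → (Pseudospace.language N).Formula α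
  | .var x, .var y => (edgeSymbol N).formula₂ (Term.var x) (Term.var y)
  | .bot, .var x => levelF N 0 (.var x)
  | .var x, .bot => levelF N 0 (.var x)
  | .top, .var x => levelF N N (.var x)
  | .var x, .top => levelF N N (.var x)
  | _, _ => ⊥

/-- There are actual vertices `z₀ = x, z₁, …, z_k = y`, successive ones being linked, such that
`P j` holds for every `j` (in `P`, the variable `Sum.inr j` stands for `z_j`). -/
noncomputable def pathF {α : Type} (k : ℕ) (x y : α)
    (P : Fin (k + 1) → (Pseudospace.language N).Formula (α ⊕ Fin (k + 1))) :
    (Pseudospace.language N).Formula α :=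
  Formula.iExs (Fin (k + 1)) <|
    eqF N (Sum.inr 0) (Sum.inl x) ⊓ eqF N (Sum.inr (Fin.last k)) (Sum.inl y) ⊓
    Formula.iInf (fun j : Fin k =>
      edgeF N (.var (Sum.inr j.castSucc)) (.var (Sum.inr j.succ))) ⊓
    Formula.iInf P

/-- `x` lies beneath `y`: for actual vertices this means that for some `l < r` in `[0, N]` there is
a path `x = z_l, z_{l+1}, …, z_r = y` with `z_k ∈ 𝒜_k`. -/
noncomputable def beneathF {α : Type} :
    Vertex α → Vertex α → (Pseudospace.language N).Formula α
  | .var x, .var y =>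
    Formula.iSup (fun p : {p : Fin (N + 1) × Fin (N + 1) // p.1 < p.2} =>
      pathF N (p.1.2.val - p.1.1.val) x y
        (fun j => levelF N (p.1.1.val + j.val) (.var (Sum.inr j))))
  | .bot, .var _ => ⊤
  | .bot, .top => ⊤
  | .var _, .top => ⊤
  | _, _ => ⊥

/-- `x` lies between `a` and `b`. -/
noncomputable def betweenF {α : Type} (a b : Vertex α) (x : α) :
    (Pseudospace.language N).Formula α :=
  beneathF N a (.var x) ⊓ beneathF N (.var x) b

/-- The actual vertex `x` is different from `a`. -/
def neF {α : Type} (x : α) : Vertex α → (Pseudospace.language N).Formula α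
  | .var y => ∼(eqF N x y)
  | _ => ⊤

/-- The level of the actual vertex `x` belongs to the interval `[c, d]`. -/
noncomputable def levelInF {α : Type} (c d : ℤ) (x : α) :
    (Pseudospace.language N).Formula α :=
  Formula.iSup (fun i : Set.Icc c d => levelF N i (.var x))

/-- The vertex expression to be used for a vertex of level `i`: the imaginary vertex of that level
if `i = -1` or `i = N + 1`, and the variable `x` otherwise. -/
def vertexAt {α : Type} (i : ℤ) (x : α) : Vertex α :=
  if i = -1 then .bot else if i = N + 1 then .top else .var x

/-- The universal closure of a formula in finitely many variables. -/
noncomputable def allF {α : Type} [Finite α] (φ : (Pseudospace.language N).Formula α) :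
    (Pseudospace.language N).Sentence :=
  Formula.iAlls α (φ.relabel (Sum.inr : α → Empty ⊕ α))

/-- The axioms of colored `N`-spaces: every vertex has exactly one level, edges are symmetric, and
a vertex of level `i` is linked only to vertices of levels `i - 1` and `i + 1`
(in particular, there are no edges from a vertex to itself). -/
noncomputable def coloredSpace : (Pseudospace.language N).Theory :=
  {allF N (levelInF N 0 N (0 : Fin 1)),
    allF N (edgeF N (.var (0 : Fin 2)) (.var 1) ⟹ edgeF N (.var 1) (.var 0))} ∪
  {φ | ∃ i j : ℤ, i ≠ j ∧
    φ = allF N (∼(levelF N i (.var (0 : Fin 1)) ⊓ levelF N j (.var 0)))} ∪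
  {φ | ∃ i : ℤ, 0 ≤ i ∧ i ≤ N ∧
    φ = allF N (levelF N i (.var (0 : Fin 2)) ⊓ edgeF N (.var 0) (.var 1) ⟹
      levelF N (i - 1) (.var 1) ⊔ levelF N (i + 1) (.var 1))}

/-- The instance of simple connectedness for the levels `l < r`, the interval `t = [c, d] ⊆ [l, r]`
and the length `k`: if `a ∈ 𝒜_l` lies beneath `b ∈ 𝒜_r`, and `x`, `y` lie between `a` and `b` and
are connected by a path of length `k` in `𝒜_t` not passing through `a` nor `b`, then they are
connected by a path of length at most `k` in `𝒜_t` all of whose vertices lie between `a` and `b`.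
The variables `0, 1, 2, 3` stand for `a, b, x, y`.
(An imaginary vertex in `𝒜_t` can only be `a` or `b`, so all paths here consist of actual
vertices. Repetitions on a path can always be cut out.) -/
noncomputable def simplyConnectedAxiom (l r c d : ℤ) (k : ℕ) :
    (Pseudospace.language N).Sentence :=
  let a : Vertex (Fin 4) := vertexAt N l 0
  let b : Vertex (Fin 4) := vertexAt N r 1
  let x : Fin 4 := 2
  let y : Fin 4 := 3
  allF N <|
    levelF N l a ⊓ levelF N r b ⊓ beneathF N a b ⊓ betweenF N a b x ⊓ betweenF N a b y ⊓
      pathF N k x y (fun j => levelInF N c d (Sum.inr j) ⊓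
        neF N (Sum.inr j) (a.map Sum.inl) ⊓ neF N (Sum.inr j) (b.map Sum.inl)) ⟹
    Formula.iSup (fun m : Fin (k + 1) =>
      pathF N m x y (fun j => levelInF N c d (Sum.inr j) ⊓
        betweenF N (a.map Sum.inl) (b.map Sum.inl) (Sum.inr j)))

/-- The instance of the extension property for the interval `s = (l, r)` with `r = l + w + 2`
(so `s` has `w + 1` elements), for sets `{c₁, …, c_n}` and for the distance bound `k`:
if `a ∈ 𝒜_l` lies beneath `b ∈ 𝒜_r`, there is a path `a, z_{l+1}, …, z_{r-1}, b` with `z_i ∈ 𝒜_i`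
such that the distance in `𝒜_s` from every `z_i` to every `c_j ∈ 𝒜_s` is greater than `k`.
(Whether `a` and `b` are among the `c_j` is irrelevant, as their levels are not in `s`.)
The variable `Sum.inl j` stands for `c_j`, and `Sum.inr 0`, `Sum.inr 1` stand for `a`, `b`; under
the existential quantifier the variable `Sum.inr i` stands for `z_{l+1+i}`. -/
noncomputable def extensionAxiom (l : ℤ) (w n k : ℕ) : (Pseudospace.language N).Sentence :=
  let r : ℤ := l + w + 2
  let a : Vertex (Fin n ⊕ Fin 2) := vertexAt N l (Sum.inr 0)
  let b : Vertex (Fin n ⊕ Fin 2) := vertexAt N r (Sum.inr 1)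
  allF N <|
    levelF N l a ⊓ levelF N r b ⊓ beneathF N a b ⟹
    Formula.iExs (Fin (w + 1)) (
      Formula.iInf (fun i : Fin (w + 1) => levelF N (l + 1 + i.val) (.var (Sum.inr i))) ⊓
      edgeF N (a.map Sum.inl) (.var (Sum.inr 0)) ⊓
      Formula.iInf (fun i : Fin w =>
        edgeF N (.var (Sum.inr i.castSucc)) (.var (Sum.inr i.succ))) ⊓
      edgeF N (.var (Sum.inr (Fin.last w))) (b.map Sum.inl) ⊓
      Formula.iInf (fun i : Fin (w + 1) => Formula.iInf (fun j : Fin n =>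
        ∼(Formula.iSup (fun m : Fin (k + 1) =>
          pathF N m (Sum.inr i) (Sum.inl (Sum.inl j))
            (fun q => levelInF N (l + 1) (r - 1) (Sum.inr q)))))))

end Formulas

/-- The theory `PS_N` of the `N`-dimensional free pseudospace. -/
noncomputable def PS (N : ℕ) : (Pseudospace.language N).Theory :=
  coloredSpace N ∪
  {φ | ∃ (l r c d : ℤ) (k : ℕ), -1 ≤ l ∧ l < r ∧ r ≤ N + 1 ∧ l ≤ c ∧ c ≤ d ∧ d ≤ r ∧
    φ = simplyConnectedAxiom N l r c d k} ∪
  {φ | ∃ (l : ℤ) (w n k : ℕ), -1 ≤ l ∧ l + w + 2 ≤ N + 1 ∧ φ = extensionAxiom N l w n k}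

end Pseudospace

/-! The types over `A` are counted by a back-and-forth argument in an ultrapower of `M`, which
realizes all types over `A`. By saturation its graph, completed by the two imaginary vertices, is
`Rich`: between any `a` beneath `c` with a gap of levels there is a path at infinite distance, in
the open band of levels, from a given countable set.

The work is done with `Nice` sets `D`, which contain witnesses for the relation "beneath" and for
connectedness in every band. A path from `a ∈ D` to `c ∈ D` is free if no inner vertex is connected
to `D` in the open band. Its only edges to `D` are those at `a` and `c` (`FreePath.adj_iff`), so
adjoining it yields one isomorphism type, and the result is again nice (`FreePath.nice_adjoin`).

Every vertex enters a nice set after finitely many such adjunctions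
(`SimplyConnected.exists_reach`). This rests on simple connectedness, which makes the components of
a band, together with the vertices of the next level, a forest (`eq_of_conn_diff_comp`). The forest
gives a Helly property (`helly`): if the component of a vertex between `a` and `c` meets `D`, it
contains a vertex of `D` between `a` and `c`.

Hence isomorphisms of countable nice sets have the back-and-forth property and preserve all formulas
(`realize_iff_of_isIso`). Starting from a countable nice set containing `A`, one free path chosen
for each pair of endpoints at each stage gives a countable family of nice sets, into which every
finite tuple can be moved by an isomorphism fixing `A`. So there are only countably many types. -/

/-! ### Walks and connectedness inside a set of vertices. -/

/-- `WalkIn r S n x y`: there is a walk of length `n` from `x` to `y` along the relation `r`, all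
of whose vertices belong to `S`. -/
inductive WalkIn {V : Type*} (r : V → V → Prop) (S : Set V) : ℕ → V → V → Prop
  | nil {x : V} : x ∈ S → WalkIn r S 0 x x
  | cons {n : ℕ} {x y z : V} : x ∈ S → r x y → WalkIn r S n y z → WalkIn r S (n + 1) x z

/-- `x` and `y` are joined by a walk within `S`. -/
def ConnIn {V : Type*} (r : V → V → Prop) (S : Set V) (x y : V) : Prop :=
  ∃ n, WalkIn r S n x y

section Walks

variable {V : Type*} {r : V → V → Prop} {S T : Set V} {x y z : V} {m n : ℕ}

namespace WalkIn

theorem left_mem (h : WalkIn r S n x y) : x ∈ S := by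
  cases h <;> assumption

theorem right_mem (h : WalkIn r S n x y) : y ∈ S := by
  induction h <;> assumption

theorem mono (hST : S ⊆ T) (h : WalkIn r S n x y) : WalkIn r T n x y := by
  induction h with
  | nil hx => exact .nil (hST hx)
  | cons hx hr _ ih => exact .cons (hST hx) hr ih

theorem trans (h : WalkIn r S m x y) (h' : WalkIn r S n y z) : ∃ k, WalkIn r S k x z := by
  induction h with
  | nil _ => exact ⟨_, h'⟩
  | cons hx hr _ ih => obtain ⟨k, hk⟩ := ih h'; exact ⟨_, .cons hx hr hk⟩

/-- A walk leaving `K` has a last step out of `K`. -/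
theorem last_exit {K : Set V} (h : WalkIn r S n x y) (hx : x ∈ K) (hy : y ∉ K) :
    ∃ k v m, k ∈ K ∧ k ∈ S ∧ v ∉ K ∧ r k v ∧ m < n ∧ WalkIn r (S \ K) m v y := by
  have key : ∀ {n x}, WalkIn r S n x y → WalkIn r (S \ K) n x y ∨
      ∃ k v m, k ∈ K ∧ k ∈ S ∧ v ∉ K ∧ r k v ∧ m < n ∧ WalkIn r (S \ K) m v y := by
    clear h
    intro n x h
    induction h with
    | nil hx => exact .inl (.nil ⟨hx, hy⟩)
    | @cons n x u z hx hr hw ih =>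
      rcases ih hy with h | ⟨k, v, m, h1, h2, h3, h4, h5, h6⟩
      · by_cases hK : x ∈ K
        · exact .inr ⟨x, u, n, hK, hx, h.left_mem.2, hr, n.lt_succ_self, h⟩
        · exact .inl (.cons ⟨hx, hK⟩ hr h)
      · exact .inr ⟨k, v, m, h1, h2, h3, h4, h5.trans n.lt_succ_self, h6⟩
  rcases key h with h | h
  · exact absurd hx h.left_mem.2
  · exact h

end WalkIn

theorem walkIn_iff_exists_fin : WalkIn r S n x y ↔ ∃ z : Fin (n + 1) → V, z 0 = x ∧
    z (Fin.last n) = y ∧ (∀ j : Fin n, r (z j.castSucc) (z j.succ)) ∧ ∀ j, z j ∈ S := by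
  constructor
  · intro h
    induction h with
    | @nil x hx => exact ⟨fun _ => x, rfl, rfl, fun j => j.elim0, fun _ => hx⟩
    | @cons n x u y hx hr hw ih =>
      obtain ⟨z, h0, h1, h2, h3⟩ := ih
      refine ⟨Fin.cons x z, rfl, ?_, ?_, ?_⟩
      · rw [← Fin.succ_last, Fin.cons_succ, h1]
      · intro j
        induction j using Fin.cases with
        | zero => simpa [h0] using hr
        | succ j => simpa [← Fin.succ_castSucc] using h2 j
      · intro j
        induction j using Fin.cases with
        | zero => simpa using hx
        | succ j => simpa using h3 j
  · rintro ⟨z, rfl, rfl, h2, h3⟩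
    induction n with
    | zero => exact .nil (h3 0)
    | succ n ih =>
      have h := ih (fun j => z j.succ) (fun j => h2 j.succ)
        (fun j => h3 _)
      rw [Fin.succ_last] at h
      exact .cons (h3 0) (h2 0) h

namespace ConnIn

theorem refl (hx : x ∈ S) : ConnIn r S x x := ⟨0, .nil hx⟩

theorem left_mem (h : ConnIn r S x y) : x ∈ S := h.choose_spec.left_mem

theorem right_mem (h : ConnIn r S x y) : y ∈ S := h.choose_spec.right_mem

theorem mono (hST : S ⊆ T) (h : ConnIn r S x y) : ConnIn r T x y := ⟨_, h.choose_spec.mono hST⟩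

theorem trans (h : ConnIn r S x y) (h' : ConnIn r S y z) : ConnIn r S x z :=
  h.choose_spec.trans h'.choose_spec

theorem single (hx : x ∈ S) (hy : y ∈ S) (h : r x y) : ConnIn r S x y := ⟨1, .cons hx h (.nil hy)⟩

theorem symm (hr : ∀ x y, r x y → r y x) (h : ConnIn r S x y) : ConnIn r S y x := by
  obtain ⟨n, h⟩ := h
  induction h with
  | nil hx => exact refl hx
  | cons hx h hw ih => exact ih.trans (single hw.left_mem hx (hr _ _ h))

theorem last_exit {K : Set V} (h : ConnIn r S x y) (hx : x ∈ K) (hy : y ∉ K) :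
    ∃ k v, k ∈ K ∧ k ∈ S ∧ v ∉ K ∧ r k v ∧ ConnIn r (S \ K) v y := by
  obtain ⟨n, h⟩ := h
  obtain ⟨k, v, m, h1, h2, h3, h4, -, h5⟩ := h.last_exit hx hy
  exact ⟨k, v, h1, h2, h3, h4, m, h5⟩

end ConnIn

end Walks

/-! ### Leveled graphs, duality, and paths through consecutive levels. -/

/-- A graph with vertices of levels `0, …, rank`, together with one vertex `bot` of level `-1` and
one vertex `top` of level `rank + 1`, in which only vertices of consecutive levels are linked. -/
structure LeveledGraph (V : Type*) where
  rank : ℤ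
  lev : V → ℤ
  adj : V → V → Prop
  bot : V
  top : V
  rank_nonneg : 0 ≤ rank
  adj_symm : ∀ x y, adj x y → adj y x
  lev_of_adj : ∀ x y, adj x y → lev y = lev x + 1 ∨ lev x = lev y + 1
  neg_one_le_lev : ∀ x, -1 ≤ lev x
  lev_le : ∀ x, lev x ≤ rank + 1
  lev_bot : lev bot = -1
  lev_top : lev top = rank + 1
  eq_bot : ∀ x, lev x = -1 → x = bot
  eq_top : ∀ x, lev x = rank + 1 → x = top

namespace LeveledGraph

open Relation

variable {V : Type*} (G : LeveledGraph V)

/-- `y` is linked to `x` and one level higher. -/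
def Up (x y : V) : Prop := G.adj x y ∧ G.lev y = G.lev x + 1

/-- `x` lies beneath `y`. -/
def Lt (x y : V) : Prop := TransGen G.Up x y

/-- The vertices with level in `[i, j]`. -/
def Band (i j : ℤ) : Set V := {z | i ≤ G.lev z ∧ G.lev z ≤ j}

/-- The vertices between `a` and `b`. -/
def Between (a b : V) : Set V := {z | G.Lt a z ∧ G.Lt z b}

/-- Connectedness within a set of vertices. -/
abbrev Conn (S : Set V) (x y : V) : Prop := ConnIn G.adj S x y

/-- Simple connectedness. -/
structure SimplyConnected : Prop where
  -- `Lt` asks for genuine paths, also from and to the imaginary vertices.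
  bot_lt : ∀ x, x ≠ G.bot → G.Lt G.bot x
  lt_top : ∀ x, x ≠ G.top → G.Lt x G.top
  -- The bound on the length of the new path is dropped: connectedness suffices.
  sc : ∀ a b x y i j, G.Lt a b → G.lev a ≤ i → j ≤ G.lev b → x ∈ G.Between a b →
    y ∈ G.Between a b → G.Conn {z | z ∈ G.Band i j ∧ z ≠ a ∧ z ≠ b} x y →
    G.Conn (G.Band i j ∩ G.Between a b) x y

/-- The graph turned upside down. -/
def dual : LeveledGraph V where
  rank := G.rank
  lev x := G.rank - G.lev x
  adj := G.adj
  bot := G.top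
  top := G.bot
  rank_nonneg := G.rank_nonneg
  adj_symm := G.adj_symm
  lev_of_adj x y h := by have := G.lev_of_adj x y h; omega
  neg_one_le_lev x := by have := G.lev_le x; omega
  lev_le x := by have := G.neg_one_le_lev x; omega
  lev_bot := by have := G.lev_top; omega
  lev_top := by have := G.lev_bot; omega
  eq_bot x h := G.eq_top x (by omega)
  eq_top x h := G.eq_bot x (by omega)

variable {G}

theorem dual_up {x y : V} : G.dual.Up x y ↔ G.Up y x := by
  simp only [Up, dual]
  constructor
  · rintro ⟨h, h'⟩; exact ⟨G.adj_symm _ _ h, by omega⟩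
  · rintro ⟨h, h'⟩; exact ⟨G.adj_symm _ _ h, by omega⟩

theorem dual_lt {x y : V} : G.dual.Lt x y ↔ G.Lt y x := by
  have h : G.dual.Up = Function.swap G.Up := by
    funext x y; exact propext dual_up
  rw [Lt, h, transGen_swap]; rfl

theorem dual_between {x y : V} : G.dual.Between x y = G.Between y x := by
  ext z; simp only [Between, dual_lt, Set.mem_ofPred_eq, and_comm]

theorem dual_band {i j : ℤ} : G.dual.Band i j = G.Band (G.rank - j) (G.rank - i) := by
  ext z; simp only [Band, dual, Set.mem_ofPred_eq]; omega

theorem dual_conn {S : Set V} {x y : V} : G.dual.Conn S x y ↔ G.Conn S x y := Iff.rfl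

theorem dual_lev {x : V} : G.dual.lev x = G.rank - G.lev x := rfl

theorem dual_rank : G.dual.rank = G.rank := rfl

/-- The conditions are symmetric in top and bottom, so each fact about vertices beneath a given one
yields its mirror image. -/
theorem SimplyConnected.dual (h : G.SimplyConnected) : G.dual.SimplyConnected where
  bot_lt x hx := dual_lt.2 (h.lt_top x hx)
  lt_top x hx := dual_lt.2 (h.bot_lt x hx)
  sc a b x y i j hab hi hj hx hy hc := by
    rw [dual_between] at *
    rw [dual_band] at *
    rw [dual_lt] at hab
    rw [dual_lev] at hi hj
    refine h.sc b a x y _ _ hab (by omega) (by omega) hx hy (hc.mono fun z hz => ?_)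
    exact ⟨hz.1, hz.2.2, hz.2.1⟩

theorem Up.lt {x y : V} (h : G.Up x y) : G.Lt x y := TransGen.single h

theorem Lt.trans {x y z : V} (h : G.Lt x y) (h' : G.Lt y z) : G.Lt x z := TransGen.trans h h'

theorem Lt.lev_lt {x y : V} (h : G.Lt x y) : G.lev x < G.lev y := by
  induction h with
  | single h => have := h.2; omega
  | tail _ h ih => have := h.2; omega

theorem band_mono {i j i' j' : ℤ} (hi : i' ≤ i) (hj : j ≤ j') : G.Band i j ⊆ G.Band i' j' :=
  fun _ hz => ⟨hi.trans hz.1, hz.2.trans hj⟩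

theorem up_or_up {x y : V} (h : G.adj x y) : G.Up x y ∨ G.Up y x := by
  rcases G.lev_of_adj x y h with h' | h'
  · exact .inl ⟨h, h'⟩
  · exact .inr ⟨G.adj_symm _ _ h, h'⟩

theorem Up.adj {x y : V} (h : G.Up x y) : G.adj x y := h.1

theorem Up.adj' {x y : V} (h : G.Up x y) : G.adj y x := G.adj_symm _ _ h.1

theorem conn_symm {S : Set V} {x y : V} (h : G.Conn S x y) : G.Conn S y x := h.symm G.adj_symm

/-- Within one level, only equal vertices are connected. -/
theorem eq_of_conn_level {i : ℤ} {x y : V} (h : G.Conn (G.Band i i) x y) : x = y := by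
  obtain ⟨n, h⟩ := h
  cases h with
  | nil => rfl
  | cons hx ha hw =>
    have h1 := hx; have h2 := hw.left_mem; have h3 := G.lev_of_adj _ _ ha
    simp only [Band, Set.mem_ofPred_eq] at h1 h2
    omega

/-- `b i` is a path from `a` to `c` through consecutive levels, `b i` being its vertex of
level `i`. -/
structure IsPath (G : LeveledGraph V) (a c : V) (b : ℤ → V) : Prop where
  left : b (G.lev a) = a
  right : b (G.lev c) = c
  up : ∀ i, G.lev a ≤ i → i < G.lev c → G.Up (b i) (b (i + 1))

namespace IsPath

variable {a c : V} {b : ℤ → V}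

theorem lev_eq (h : G.IsPath a c b) {i : ℤ} (hi : G.lev a ≤ i) (hi' : i ≤ G.lev c) :
    G.lev (b i) = i := by
  induction i, hi using Int.leInduction with
  | base => rw [h.left]
  | succ i hi ih => rw [(h.up i hi (by omega)).2, ih (by omega)]

theorem lt (h : G.IsPath a c b) {i j : ℤ} (hi : G.lev a ≤ i) (hij : i < j) (hj : j ≤ G.lev c) :
    G.Lt (b i) (b j) := by
  induction j, hij using Int.leInduction with
  | base => exact (h.up i hi (by omega)).lt
  | succ j hij ih => exact (ih (by omega)).trans (h.up j (by omega) (by omega)).lt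

theorem conn (h : G.IsPath a c b) {i j : ℤ} (hi : G.lev a ≤ i) (hij : i ≤ j) (hj : j ≤ G.lev c) :
    G.Conn {z | ∃ k, i ≤ k ∧ k ≤ j ∧ b k = z} (b i) (b j) := by
  induction j, hij using Int.leInduction with
  | base => exact .refl ⟨i, le_rfl, le_rfl, rfl⟩
  | succ j hij ih =>
    refine ((ih (by omega)).mono ?_).trans (.single ?_ ?_ (h.up j (by omega) (by omega)).1)
    · rintro z ⟨k, h1, h2, h3⟩; exact ⟨k, h1, by omega, h3⟩
    · exact ⟨j, hij, by omega, rfl⟩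
    · exact ⟨j + 1, by omega, le_rfl, rfl⟩

theorem conn_band (h : G.IsPath a c b) {i j k l : ℤ} (hi : G.lev a ≤ i) (hi' : i ≤ G.lev c)
    (hj : G.lev a ≤ j) (hj' : j ≤ G.lev c) (hki : k ≤ i) (hil : i ≤ l) (hkj : k ≤ j) (hjl : j ≤ l) :
    G.Conn (G.Band k l) (b i) (b j) := by
  have key : ∀ i j, i ≤ j → G.lev a ≤ i → j ≤ G.lev c → k ≤ i → j ≤ l →
      G.Conn (G.Band k l) (b i) (b j) := by
    intro i j hij hi hj hk hl
    refine (h.conn hi hij hj).mono ?_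
    rintro z ⟨m, h1, h2, rfl⟩
    have := h.lev_eq (i := m) (by omega) (by omega)
    simp only [Band, Set.mem_ofPred_eq]; omega
  rcases le_total i j with hij | hij
  · exact key i j hij hi hj' hki hjl
  · exact conn_symm (key j i hij hj hi' hkj hil)

theorem trans {p : V} {b' : ℤ → V} (h : G.IsPath a p b) (h' : G.IsPath p c b')
    (hap : G.lev a ≤ G.lev p) (hpc : G.lev p ≤ G.lev c) :
    G.IsPath a c (fun i => if i ≤ G.lev p then b i else b' i) := by
  refine ⟨?_, ?_, ?_⟩
  · simp [hap, h.left]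
  · by_cases hc : G.lev c ≤ G.lev p
    · have hcp : G.lev c = G.lev p := le_antisymm hc hpc
      simp only [hcp, le_refl, if_true]
      rw [h.right, ← h'.right, hcp, h'.left]
    · simp [hc, h'.right]
  · intro i hi hi'
    by_cases h1 : i + 1 ≤ G.lev p
    · have h2 : i ≤ G.lev p := by omega
      simpa only [h1, h2, if_true] using h.up i hi (by omega)
    · by_cases h2 : i ≤ G.lev p
      · obtain rfl : i = G.lev p := by omega
        simp only [le_refl, h1, if_true, if_false]
        rw [h.right]
        simpa only [h'.left] using h'.up _ le_rfl hi'
      · simpa only [h1, h2, if_false] using h'.up i (by omega) hi'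

theorem dual (h : G.IsPath a c b) : G.dual.IsPath c a (fun i => b (G.rank - i)) := by
  refine ⟨?_, ?_, ?_⟩
  · simp [dual_lev, h.right]
  · simp [dual_lev, h.left]
  · intro i hi hi'
    rw [dual_lev] at hi hi'
    rw [dual_up]
    have := h.up (G.rank - (i + 1)) (by omega) (by omega)
    rwa [show G.rank - (i + 1) + 1 = G.rank - i by omega] at this

end IsPath

theorem Up.isPath {x y : V} (h : G.Up x y) :
    G.IsPath x y (fun i => if i ≤ G.lev x then x else y) := by
  have := h.2
  refine ⟨by simp, by simp [this], fun i hi hi' => ?_⟩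
  obtain rfl : i = G.lev x := by omega
  simpa using h

theorem Lt.exists_isPath {a c : V} (h : G.Lt a c) : ∃ b, G.IsPath a c b := by
  induction h with
  | single h => exact ⟨_, h.isPath⟩
  | tail h h' ih =>
    obtain ⟨b, hb⟩ := ih
    exact ⟨_, hb.trans h'.isPath (le_of_lt (Lt.lev_lt h)) (le_of_lt h'.lt.lev_lt)⟩

theorem exists_isPath_through {a p c : V} (h : G.Lt a p) (h' : G.Lt p c) :
    ∃ b, G.IsPath a c b ∧ b (G.lev p) = p := by
  obtain ⟨b, hb⟩ := h.exists_isPath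
  obtain ⟨b', hb'⟩ := h'.exists_isPath
  exact ⟨_, hb.trans hb' h.lev_lt.le h'.lev_lt.le, by simp [hb.right]⟩

theorem Lt.conn_band {x y : V} (h : G.Lt x y) {i j : ℤ} (hi : i ≤ G.lev x) (hj : G.lev y ≤ j) :
    G.Conn (G.Band i j) x y := by
  obtain ⟨b, hb⟩ := h.exists_isPath
  have h1 := h.lev_lt
  have := hb.conn_band (i := G.lev x) (j := G.lev y) (k := i) (l := j) le_rfl h1.le h1.le le_rfl hi
    (by omega) (by omega) hj
  rwa [hb.left, hb.right] at this

end LeveledGraph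

/-! ### The forest structure of bands, nice sets and the Helly property. -/

namespace LeveledGraph

open Relation

variable {V : Type*} {G : LeveledGraph V}

/-- The vertices of a band that lie beneath `v` and are connected outside `v` are connected
beneath `v`. -/
theorem SimplyConnected.conn_below (h : G.SimplyConnected) {i j : ℤ} {v x y : V} (hi : 0 ≤ i)
    (hj : j ≤ G.lev v) (hx : G.Lt x v) (hy : G.Lt y v) (hc : G.Conn (G.Band i j \ {v}) x y) :
    G.Conn (G.Band i j ∩ {z | G.Lt z v}) x y := by
  have hbot := G.lev_bot
  have ne_bot : ∀ z, z ∈ G.Band i j → z ≠ G.bot := by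
    rintro z hz rfl
    have := hz.1; omega
  have hxb := ne_bot x hc.left_mem.1
  have hyb := ne_bot y hc.right_mem.1
  refine (h.sc G.bot v x y i j ((h.bot_lt x hxb).trans hx) (by omega) hj
    ⟨h.bot_lt x hxb, hx⟩ ⟨h.bot_lt y hyb, hy⟩ (hc.mono ?_)).mono ?_
  · exact fun z hz => ⟨hz.1, ne_bot z hz.1, hz.2⟩
  · exact fun z hz => ⟨hz.1, hz.2.2⟩

theorem SimplyConnected.conn_above (h : G.SimplyConnected) {i j : ℤ} {v x y : V}
    (hi : G.lev v ≤ i) (hj : j ≤ G.rank) (hx : G.Lt v x) (hy : G.Lt v y)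
    (hc : G.Conn (G.Band i j \ {v}) x y) : G.Conn (G.Band i j ∩ {z | G.Lt v z}) x y := by
  have := h.dual.conn_below (i := G.rank - j) (j := G.rank - i) (v := v) (x := x) (y := y)
    (by omega) (by rw [dual_lev]; omega) (dual_lt.2 hx) (dual_lt.2 hy)
    (by simpa [dual_band, dual_conn] using hc)
  simpa [dual_band, dual_lt, dual_conn] using this

/-- The connected component of `k` in the band `[i, j]`. -/
def Comp (G : LeveledGraph V) (i j : ℤ) (k : V) : Set V := {z | G.Conn (G.Band i j) k z}

theorem comp_subset_band {i j : ℤ} {k : V} : G.Comp i j k ⊆ G.Band i j :=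
  fun _ hz => hz.right_mem

theorem Comp.conn {i j : ℤ} {k x y : V} (hx : x ∈ G.Comp i j k) (hy : y ∈ G.Comp i j k) :
    G.Conn (G.Band i j) x y := (conn_symm hx).trans hy

/-- A neighbour of level below `j` would itself belong to the component, so the component can only
be left upwards. -/
theorem comp_exit {i j : ℤ} {k m v : V} (hm : m ∈ G.Comp i (j - 1) k) (hv : v ∈ G.Band i j)
    (hvK : v ∉ G.Comp i (j - 1) k) (ha : G.adj m v) : G.lev v = j ∧ G.Up m v := by
  have hmB := comp_subset_band hm
  have hvj : G.lev v = j := by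
    by_contra hne
    have h2 := hv.2
    have : v ∈ G.Band i (j - 1) := ⟨hv.1, by omega⟩
    exact hvK (ConnIn.trans hm (.single hmB this ha))
  refine ⟨hvj, ha, ?_⟩
  have h1 := G.lev_of_adj _ _ ha
  have := hmB.2
  omega

/-- The components of the band `[i, j - 1]` and the vertices of level `j` form a forest. -/
theorem SimplyConnected.eq_of_conn_diff_comp (h : G.SimplyConnected) {i j : ℤ} (hi : 0 ≤ i)
    {k k₁ k₂ v₁ v₂ : V} (hk₁ : k₁ ∈ G.Comp i (j - 1) k) (hk₂ : k₂ ∈ G.Comp i (j - 1) k)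
    (h₁ : G.Up k₁ v₁) (h₂ : G.Up k₂ v₂) (hv₁ : G.lev v₁ = j)
    (hc : G.Conn (G.Band i j \ G.Comp i (j - 1) k) v₁ v₂) : v₁ = v₂ := by
  by_contra hne
  -- After its last visit to `v₁` the walk goes down to some `u` outside the component. From `u` it
  -- is possible to reach `k₁` through `v₂` and the component, avoiding `v₁`. Simple connectedness
  -- beneath `v₁` then joins `u` to `k₁` below level `j`, so `u` is in the component after all.
  obtain ⟨k', u, hk', -, hu, ha, hw⟩ := hc.last_exit (K := {v₁}) rfl (fun h => hne h.symm)
  obtain rfl : k' = v₁ := hk'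
  have huB := hw.left_mem.1.1
  have hup : G.Up u k' := by
    rcases up_or_up ha with h' | h'
    · have := h'.2; have := huB.2; omega
    · exact h'
  have sub : G.Band i (j - 1) ⊆ G.Band i j \ {k'} := by
    rintro z hz
    refine ⟨band_mono le_rfl (by omega) hz, ?_⟩
    rintro rfl
    have := hz.2; omega
  have c1 : G.Conn (G.Band i j \ {k'}) u v₂ := hw.mono fun z hz => ⟨hz.1.1, hz.2⟩
  have c2 : G.Conn (G.Band i j \ {k'}) v₂ k₂ :=
    .single c1.right_mem (sub (comp_subset_band hk₂)) h₂.adj'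
  have c3 : G.Conn (G.Band i j \ {k'}) k₂ k₁ := (Comp.conn hk₂ hk₁).mono sub
  have c4 := h.conn_below hi hv₁.ge hup.lt h₁.lt ((c1.trans c2).trans c3)
  have c5 : G.Conn (G.Band i (j - 1)) k₁ u := conn_symm (c4.mono fun z hz => by
    have := Lt.lev_lt hz.2
    exact ⟨hz.1.1, by omega⟩)
  exact hw.left_mem.1.2 (ConnIn.trans hk₁ c5)

/-- Two walks from a common vertex outside a component of the band `[i, j - 1]` into this component
enter it through the same vertex of level `j`. -/
theorem SimplyConnected.common_entrance (h : G.SimplyConnected) {i j : ℤ} (hi : 0 ≤ i)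
    {Z₁ Z₂ : Set V} {k k₁ k₂ z : V} (hk₁ : k₁ ∈ G.Comp i (j - 1) k) (hk₂ : k₂ ∈ G.Comp i (j - 1) k)
    (hz : z ∉ G.Comp i (j - 1) k) (h₁ : G.Conn (G.Band i j ∩ Z₁) z k₁)
    (h₂ : G.Conn (G.Band i j ∩ Z₂) z k₂) :
    ∃ v m₁ m₂, G.lev v = j ∧ v ∈ Z₁ ∧ v ∈ Z₂ ∧ m₁ ∈ G.Comp i (j - 1) k ∧ m₁ ∈ Z₁ ∧ G.Up m₁ v ∧
      m₂ ∈ G.Comp i (j - 1) k ∧ m₂ ∈ Z₂ ∧ G.Up m₂ v := by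
  obtain ⟨m₁, v₁, a1, a2, a3, a4, a5⟩ := (conn_symm h₁).last_exit hk₁ hz
  obtain ⟨m₂, v₂, b1, b2, b3, b4, b5⟩ := (conn_symm h₂).last_exit hk₂ hz
  obtain ⟨l1, u1⟩ := comp_exit a1 a5.left_mem.1.1 a3 a4
  obtain ⟨l2, u2⟩ := comp_exit b1 b5.left_mem.1.1 b3 b4
  have c1 : G.Conn (G.Band i j \ G.Comp i (j - 1) k) v₁ z := a5.mono fun x hx => ⟨hx.1.1, hx.2⟩
  have c2 : G.Conn (G.Band i j \ G.Comp i (j - 1) k) v₂ z := b5.mono fun x hx => ⟨hx.1.1, hx.2⟩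
  have : v₁ = v₂ := h.eq_of_conn_diff_comp hi a1 b1 u1 u2 l1 (c1.trans (conn_symm c2))
  subst this
  exact ⟨v₁, m₁, m₂, l1, a5.left_mem.1.2, b5.left_mem.1.2, a1, a2.2, u1, b1, b2.2, u2⟩

/-- A set of vertices is nice if it contains the two extremal vertices, paths through consecutive
levels between its vertices (whenever there are any) and, for any band, walks within the band
between its vertices (whenever there are any). -/
structure Nice (G : LeveledGraph V) (D : Set V) : Prop where
  bot_mem : G.bot ∈ D
  top_mem : G.top ∈ D
  path : ∀ a ∈ D, ∀ c ∈ D, G.Lt a c → TransGen (fun x y => G.Up x y ∧ x ∈ D ∧ y ∈ D) a c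
  conn : ∀ i j, 0 ≤ i → j ≤ G.rank → ∀ x ∈ D, ∀ y ∈ D, G.Conn (G.Band i j) x y →
    G.Conn (G.Band i j ∩ D) x y

theorem Nice.dual {D : Set V} (h : G.Nice D) : G.dual.Nice D where
  bot_mem := h.top_mem
  top_mem := h.bot_mem
  path a ha c hc hac := by
    have := h.path c hc a ha (dual_lt.1 hac)
    rw [← transGen_swap] at this
    exact TransGen.mono (fun x y hxy => ⟨dual_up.2 hxy.1, hxy.2.2, hxy.2.1⟩) _ _ this
  conn i j hi hj x hx y hy hc := by
    rw [dual_band] at *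
    rw [dual_rank] at hj
    exact h.conn _ _ (by omega) (by omega) x hx y hy hc

/-- If a component of a band below `c` meets a nice set containing `c` and contains a vertex beneath
`c`, then it contains a vertex of the nice set beneath `c`. -/
theorem SimplyConnected.exists_lt (h : G.SimplyConnected) {D : Set V} (hD : G.Nice D) {c p d : V}
    {i j : ℤ} (hc : c ∈ D) (hi : 0 ≤ i) (hj : j < G.lev c) (hp : G.Lt p c)
    (hpd : G.Conn (G.Band i j) p d) (hd : d ∈ D) :
    ∃ f ∈ D, G.Lt f c ∧ G.Conn (G.Band i j) p f := by
  -- For the top vertex any vertex of `D` will do. Once it is excluded, all bands up to `c` have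
  -- levels in `[0, rank]`, where niceness applies.
  by_cases hctop : c = G.top
  · refine ⟨d, hd, hctop ▸ h.lt_top d ?_, hpd⟩
    rintro rfl
    have := hpd.right_mem.2
    rw [hctop] at hj; omega
  have hcr : G.lev c ≤ G.rank := by
    have := G.lev_le c
    by_contra hh
    exact hctop (G.eq_top c (by omega))
  -- Descending induction on `j`, from the level just below `c`.
  obtain ⟨n, hn⟩ : ∃ n : ℕ, j = G.lev c - 1 - n := ⟨(G.lev c - 1 - j).toNat, by omega⟩
  induction n generalizing j with
  | zero =>
    simp only [Nat.cast_zero, sub_zero] at hn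
    subst hn
    have hpB := hpd.left_mem
    have c1 : G.Conn (G.Band i (G.lev c)) p c := hp.conn_band hpB.1 le_rfl
    have c2 : G.Conn (G.Band i (G.lev c)) p d := hpd.mono (band_mono le_rfl (by omega))
    -- A walk inside `D` from `c` to `d`: the vertex after its last visit to `c` is in `D` and
    -- directly beneath `c`.
    have c3 := hD.conn _ _ hi hcr c hc d hd ((conn_symm c1).trans c2)
    have hdc : d ≠ c := by
      rintro rfl
      have := hpd.right_mem.2; omega
    obtain ⟨k, f, hk, -, hf, ha, hw⟩ := c3.last_exit (K := {c}) rfl hdc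
    obtain rfl : k = c := hk
    have hfB := hw.left_mem.1.1
    have hup : G.Up f k := by
      rcases up_or_up ha with h' | h'
      · have := h'.2; have := hfB.2; omega
      · exact h'
    have c4 : G.Conn (G.Band i (G.lev k) \ {k}) p f := by
      refine ConnIn.trans (y := d) (hpd.mono ?_) (conn_symm (hw.mono ?_))
      · intro z hz
        refine ⟨band_mono le_rfl (by omega) hz, ?_⟩
        rintro rfl
        have := hz.2; omega
      · exact fun z hz => ⟨hz.1.1, hz.2⟩
    refine ⟨f, hw.left_mem.1.2, hup.lt, (h.conn_below hi le_rfl hp hup.lt c4).mono ?_⟩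
    intro z hz
    have := Lt.lev_lt hz.2
    exact ⟨hz.1.1, by omega⟩
  | succ n ih =>
    obtain ⟨f, hf, hfc, hpf⟩ := ih (j := j + 1) (by push_cast at hn; omega)
      (hpd.mono (band_mono le_rfl (by omega))) (by push_cast at hn; omega)
    by_cases hfK : G.Conn (G.Band i j) p f
    · exact ⟨f, hf, hfc, hfK⟩
    have hjj : j = j + 1 - 1 := by omega
    have hpK : p ∈ G.Comp i (j + 1 - 1) p := by rw [← hjj]; exact .refl hpd.left_mem
    have hdK : d ∈ G.Comp i (j + 1 - 1) p := by rw [← hjj]; exact hpd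
    have hfK' : f ∉ G.Comp i (j + 1 - 1) p := by rw [← hjj]; exact hfK
    have hjc : j + 1 < G.lev c := by push_cast at hn; omega
    have c1 : G.Conn (G.Band i (j + 1) ∩ D) f d := hD.conn _ _ hi (by omega) f hf d hd
      ((conn_symm hpf).trans (hpd.mono (band_mono le_rfl (by omega))))
    have c2 : G.Conn (G.Band i (j + 1) ∩ {z | G.Lt z c}) f p := by
      refine h.conn_below hi hjc.le hfc hp ((conn_symm hpf).mono fun z hz => ⟨hz, ?_⟩)
      rintro rfl
      have := hz.2; omega
    -- The walk from `f` to `d` inside `D` and the walk from `f` to `p` beneath `c` enter the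
    -- component of `p` through the same `v`. The second walk shows that `v` is beneath `c`, and the
    -- first provides a vertex of `D` beneath `v`.
    obtain ⟨v, m₁, -, -, -, hv2, hm1, hm2, hup, -⟩ := h.common_entrance hi hdK hpK hfK' c1 c2
    refine ⟨m₁, hm2, hup.lt.trans hv2, ?_⟩
    rw [← hjj] at hm1; exact hm1

theorem SimplyConnected.exists_gt (h : G.SimplyConnected) {D : Set V} (hD : G.Nice D) {a p d : V}
    {i j : ℤ} (ha : a ∈ D) (hi : G.lev a < i) (hj : j ≤ G.rank) (hp : G.Lt a p)
    (hpd : G.Conn (G.Band i j) p d) (hd : d ∈ D) :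
    ∃ f ∈ D, G.Lt a f ∧ G.Conn (G.Band i j) p f := by
  have hB : G.dual.Band (G.rank - j) (G.rank - i) = G.Band i j := by
    rw [dual_band]; congr 1 <;> omega
  obtain ⟨f, h1, h2, h3⟩ := h.dual.exists_lt hD.dual (i := G.rank - j) (j := G.rank - i) ha
    (by omega) (by rw [dual_lev]; omega) (dual_lt.2 hp) (by rw [hB]; exact hpd) hd
  exact ⟨f, h1, dual_lt.1 h2, by rw [hB] at h3; exact h3⟩

/-- A Helly property: if, in a component of the band above `a` up to level `j`, the vertices over
`a`, the vertices beneath `c` and the nice set `D` meet pairwise, they have a common vertex. -/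
theorem SimplyConnected.helly (h : G.SimplyConnected) {D : Set V} (hD : G.Nice D) {a c : V}
    (ha : a ∈ D) {j : ℤ} (hj : G.lev a < j) (hjc : j < G.lev c) {p q w : V}
    (hp : p ∈ G.Between a c) (hq : q ∈ D) (haq : G.Lt a q) (hw : w ∈ D) (hwc : G.Lt w c)
    (hpq : G.Conn (G.Band (G.lev a + 1) j) p q) (hpw : G.Conn (G.Band (G.lev a + 1) j) p w) :
    ∃ e ∈ D, e ∈ G.Between a c ∧ G.Conn (G.Band (G.lev a + 1) j) p e := by
  have hl := G.neg_one_le_lev a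
  have hcr := G.lev_le c
  have hi : 0 ≤ G.lev a + 1 := by omega
  -- The outer induction is on the height of the band, the inner one on the length of a walk from
  -- `p` to `q` over `a`.
  obtain ⟨n, hn⟩ : ∃ n : ℕ, j = G.lev a + 1 + n := ⟨(j - (G.lev a + 1)).toNat, by omega⟩
  induction n generalizing j p q w with
  | zero =>
    simp only [Nat.cast_zero, add_zero] at hn
    subst hn
    have hpq' := eq_of_conn_level hpq
    exact ⟨p, hpq' ▸ hq, hp, .refl hpq.left_mem⟩
  | succ n ih =>
    obtain ⟨m, hm⟩ : G.Conn (G.Band (G.lev a + 1) j ∩ {z | G.Lt a z}) p q := by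
      refine (h.conn_above (i := G.lev a + 1) (by omega) (by omega) hp.1 haq
        (hpq.mono fun z hz => ⟨hz, ?_⟩))
      rintro rfl
      have := hz.1; omega
    have hqw := hD.conn _ _ hi (by omega) q hq w hw ((conn_symm hpq).trans hpw)
    induction m using Nat.strong_induction_on generalizing p with
    | _ m ihm =>
      -- If `p` has the highest level of the band, the next vertex of the walk lies beneath `p`,
      -- hence still between `a` and `c`, and can replace `p`.
      by_cases hlp : G.lev p = j
      · cases hm with
        | nil => exact ⟨q, hq, hp, .refl hpq.left_mem⟩
        | @cons m _ u _ hpS hpu hu =>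
          have hup : G.Up u p := by
            rcases up_or_up hpu with h' | h'
            · have := h'.2; have := hu.left_mem.1.2; omega
            · exact h'
          have hpu' : G.Conn (G.Band (G.lev a + 1) j) p u :=
            .single hpS.1 hu.left_mem.1 hpu
          obtain ⟨e, he, he', hc⟩ := ihm m m.lt_succ_self
            (p := u) ⟨hu.left_mem.2, hup.lt.trans hp.2⟩ ((conn_symm hpu').trans hpq)
            ((conn_symm hpu').trans hpw) hu
          exact ⟨e, he, he', hpu'.trans hc⟩
      · have hpj : p ∈ G.Band (G.lev a + 1) (j - 1) := by
          have := hpq.left_mem; exact ⟨this.1, by have := this.2; omega⟩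
        have hpK : p ∈ G.Comp (G.lev a + 1) (j - 1) p := .refl hpj
        have hY : G.Conn (G.Band (G.lev a + 1) j ∩ {z | G.Lt z c}) p w := by
          refine h.conn_below hi hjc.le hp.2 hwc (hpw.mono fun z hz => ⟨hz, ?_⟩)
          rintro rfl
          have := hz.2; omega
        -- If the component of `p` in the lower band meets `D`, it contains vertices `q'` over `a`
        -- and `w'` beneath `c` from `D`, and the outer induction applies.
        by_cases hDK : ∃ d ∈ D, d ∈ G.Comp (G.lev a + 1) (j - 1) p
        · obtain ⟨d, hd, hdK⟩ := hDK
          obtain ⟨q', hq', haq', hpq'⟩ := h.exists_gt hD (i := G.lev a + 1) (j := j - 1) ha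
            (by omega) (by omega) hp.1 hdK hd
          obtain ⟨w', hw', hwc', hpw'⟩ : ∃ w' ∈ D, G.Lt w' c ∧
              G.Conn (G.Band (G.lev a + 1) (j - 1)) p w' := by
            by_cases hwK : w ∈ G.Comp (G.lev a + 1) (j - 1) p
            · exact ⟨w, hw, hwc, hwK⟩
            have c1 := hD.conn _ _ hi (by omega) w hw d hd
              ((conn_symm hpw).trans (ConnIn.mono (band_mono le_rfl (by omega)) hdK))
            obtain ⟨v, m₁, -, -, -, hv, hm1, hm2, hup, -⟩ :=
              h.common_entrance hi hdK hpK hwK c1 (conn_symm hY)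
            exact ⟨m₁, hm2, hup.lt.trans hv, hm1⟩
          obtain ⟨e, he, he', hc⟩ := ih (j := j - 1) (by push_cast at hn; omega) (by omega) hp hq'
            haq' hw' hwc' hpq' hpw' (by push_cast at hn; omega)
          exact ⟨e, he, he', hc.mono (band_mono le_rfl (by omega))⟩
        -- Otherwise the walk over `a` and the walk beneath `c` both leave the component. Their ends
        -- `q` and `w` are joined inside `D`, hence outside the component, so by the forest property
        -- both leave it to the same vertex. This vertex lies between `a` and `c` and is closer to
        -- `q`.
        · push Not at hDK
          obtain ⟨k₁, v₁, m', a1, a2, a3, a4, a5, a6⟩ := hm.last_exit hpK (hDK q hq)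
          obtain ⟨k₂, v₂, b1, b2, b3, b4, b5⟩ := hY.last_exit hpK (hDK w hw)
          obtain ⟨l1, u1⟩ := comp_exit a1 a6.left_mem.1.1 a3 a4
          obtain ⟨l2, u2⟩ := comp_exit b1 b5.left_mem.1.1 b3 b4
          have d1 : G.Conn (G.Band (G.lev a + 1) j \ G.Comp (G.lev a + 1) (j - 1) p) v₁ q :=
            ⟨m', a6.mono fun x hx => ⟨hx.1.1, hx.2⟩⟩
          have d2 : G.Conn (G.Band (G.lev a + 1) j \ G.Comp (G.lev a + 1) (j - 1) p) q w :=
            hqw.mono fun x hx => ⟨hx.1, hDK x hx.2⟩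
          have d3 : G.Conn (G.Band (G.lev a + 1) j \ G.Comp (G.lev a + 1) (j - 1) p) v₂ w :=
            b5.mono fun x hx => ⟨hx.1.1, hx.2⟩
          have hv := h.eq_of_conn_diff_comp hi a1 b1 u1 u2 l1 ((d1.trans d2).trans (conn_symm d3))
          subst hv
          have hpv : G.Conn (G.Band (G.lev a + 1) j) p v₁ :=
            (ConnIn.mono (band_mono le_rfl (by omega)) a1).trans
              (.single a2.1 a6.left_mem.1.1 a4)
          obtain ⟨e, he, he', hc⟩ := ihm m' a5 (p := v₁) ⟨a6.left_mem.1.2, b5.left_mem.1.2⟩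
            ((conn_symm hpv).trans hpq) ((conn_symm hpv).trans hpw)
            (a6.mono fun x hx => hx.1)
          exact ⟨e, he, he', hpv.trans hc⟩

/-- `exists_gt` and `exists_lt` supply the pairwise intersections needed for `helly`. -/
theorem SimplyConnected.exists_between (h : G.SimplyConnected) {D : Set V} (hD : G.Nice D)
    {a c p d : V} (ha : a ∈ D) (hc : c ∈ D) (hp : p ∈ G.Between a c) (hd : d ∈ D)
    (hpd : G.Conn (G.Band (G.lev a + 1) (G.lev c - 1)) p d) :
    ∃ e ∈ D, e ∈ G.Between a c ∧ G.Conn (G.Band (G.lev a + 1) (G.lev c - 1)) p e := by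
  have h1 := hp.1.lev_lt
  have h2 := hp.2.lev_lt
  have h3 := G.neg_one_le_lev a
  have h4 := G.lev_le c
  obtain ⟨q, hq, haq, hpq⟩ := h.exists_gt hD ha (by omega) (by omega) hp.1 hpd hd
  obtain ⟨w, hw, hwc, hpw⟩ := h.exists_lt hD hc (by omega) (by omega) hp.2 hpd hd
  exact h.helly hD ha (by omega) (by omega) hp hq haq hw hwc hpq hpw

end LeveledGraph

/-! ### Free paths, and sets reached by adjoining them. -/

namespace LeveledGraph

open Relation

variable {V : Type*} {G : LeveledGraph V}

/-- The path `b` from `a ∈ D` to `c ∈ D` has inner vertices, and in the band strictly between the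
levels of `a` and `c` none of them is connected to a vertex of `D`. -/
structure FreePath (G : LeveledGraph V) (D : Set V) (a c : V) (b : ℤ → V) : Prop where
  left_mem : a ∈ D
  right_mem : c ∈ D
  gap : G.lev a + 2 ≤ G.lev c
  isPath : G.IsPath a c b
  free : ∀ i, G.lev a < i → i < G.lev c → ∀ d ∈ D,
    ¬ G.Conn (G.Band (G.lev a + 1) (G.lev c - 1)) (b i) d

/-- The set `D` together with the inner vertices of the path `b` from `a` to `c`. -/
def adjoin (G : LeveledGraph V) (D : Set V) (a c : V) (b : ℤ → V) : Set V :=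
  D ∪ {x | ∃ i, G.lev a < i ∧ i < G.lev c ∧ b i = x}

theorem subset_adjoin {D : Set V} {a c : V} {b : ℤ → V} : D ⊆ G.adjoin D a c b :=
  Set.subset_union_left

theorem countable_adjoin {D : Set V} (hD : D.Countable) {a c : V} {b : ℤ → V} :
    (G.adjoin D a c b).Countable := by
  refine hD.union ((Set.countable_range b).mono ?_)
  rintro x ⟨i, -, -, rfl⟩
  exact ⟨i, rfl⟩

namespace FreePath

variable {D : Set V} {a c : V} {b : ℤ → V}

theorem dual (h : G.FreePath D a c b) : G.dual.FreePath D c a (fun i => b (G.rank - i)) where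
  left_mem := h.right_mem
  right_mem := h.left_mem
  gap := by have := h.gap; simp only [dual_lev]; omega
  isPath := h.isPath.dual
  free i hi hi' d hd := by
    rw [dual_lev] at hi hi'
    rw [dual_conn, dual_band, dual_lev, dual_lev]
    have := h.free (G.rank - i) (by omega) (by omega) d hd
    rwa [show G.rank - (G.rank - G.lev a - 1) = G.lev a + 1 by omega,
      show G.rank - (G.rank - G.lev c + 1) = G.lev c - 1 by omega]

theorem lev_eq (h : G.FreePath D a c b) {i : ℤ} (hi : G.lev a < i) (hi' : i < G.lev c) :
    G.lev (b i) = i :=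
  h.isPath.lev_eq hi.le hi'.le

theorem notMem (h : G.FreePath D a c b) {i : ℤ} (hi : G.lev a < i) (hi' : i < G.lev c) :
    b i ∉ D := by
  intro hd
  refine h.free i hi hi' _ hd (.refl ?_)
  have := h.lev_eq hi hi'
  exact ⟨by omega, by omega⟩

theorem lt_right (h : G.FreePath D a c b) {i : ℤ} (hi : G.lev a < i) (hi' : i < G.lev c) :
    G.Lt (b i) c := by
  have := h.isPath.lt hi.le hi' le_rfl
  rwa [h.isPath.right] at this

/-- A vertex of the nice set `D` over an inner vertex of a free path from `a` to `c` is `c` or lies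
over `c`. -/
theorem eq_or_lt (hG : G.SimplyConnected) (hD : G.Nice D) (h : G.FreePath D a c b) {i : ℤ}
    (hi : G.lev a < i) (hi' : i < G.lev c) {y : V} (hy : y ∈ D) (hby : G.Lt (b i) y) :
    c = y ∨ G.Lt c y := by
  have hl := G.neg_one_le_lev a
  have hgap := h.gap
  have hcr := G.lev_le c
  have hyr := G.lev_le y
  have hbl := h.lev_eq hi hi'
  have hbc := h.lt_right hi hi'
  have hlt := hby.lev_lt
  by_cases hc : c = y
  · exact .inl hc
  right
  by_cases hytop : y = G.top
  · exact hytop ▸ hG.lt_top c (fun h => hc (h.trans hytop.symm))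
  have hyr' : G.lev y ≤ G.rank := by
    by_contra hh; exact hytop (G.eq_top y (by omega))
  have hcy : G.lev c ≤ G.lev y := by
    by_contra hh
    exact h.free i hi hi' y hy (hby.conn_band (by omega) (by omega))
  -- the component of `b i` in the band of the free path does not meet `D`
  have hK : ∀ d ∈ D, d ∉ G.Comp (G.lev a + 1) (G.lev c - 1) (b i) := h.free i hi hi'
  have hcK : b (G.lev c - 1) ∈ G.Comp (G.lev a + 1) (G.lev c - 1) (b i) :=
    h.isPath.conn_band hi.le hi'.le (by omega) (by omega) (by omega) (by omega) (by omega) le_rfl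
  have hcup : G.Up (b (G.lev c - 1)) c := by
    have := h.isPath.up (G.lev c - 1) (by omega) (by omega)
    rwa [sub_add_cancel, h.isPath.right] at this
  have hbK : b i ∈ G.Comp (G.lev a + 1) (G.lev c - 1) (b i) := .refl ⟨by omega, by omega⟩
  have hbc' : G.Conn (G.Band (G.lev a + 1) (G.lev c)) (b i) c :=
    hbc.conn_band (by omega) le_rfl
  -- a vertex of `D` in the band up to the level of `c` which is connected to `b i` beneath `y`
  obtain ⟨w, hw, hbw, hwb⟩ : ∃ w ∈ D, G.Conn (G.Band (G.lev a + 1) (G.lev c)) (b i) w ∧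
      ∃ Z : Set V, Z ⊆ {z | z = y ∨ G.Lt z y} ∧
        G.Conn (G.Band (G.lev a + 1) (G.lev c) ∩ Z) (b i) w := by
    -- When `y` is on the level of `c`, `y` itself and a path up to it will do. When it is higher,
    -- `exists_lt` provides a vertex of `D` beneath `y`.
    by_cases hey : G.lev c = G.lev y
    · obtain ⟨b', hb'⟩ := hby.exists_isPath
      have hcon := hb'.conn le_rfl hlt.le le_rfl
      rw [hb'.left, hb'.right] at hcon
      refine ⟨y, hy, hby.conn_band (by omega) hey.ge, {z | z = y ∨ G.Lt z y}, subset_rfl,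
        hcon.mono ?_⟩
      rintro z ⟨k, h1, h2, rfl⟩
      have := hb'.lev_eq h1 h2
      refine ⟨⟨by omega, by omega⟩, ?_⟩
      rcases h2.lt_or_eq with h3 | rfl
      · right
        have := hb'.lt h1 h3 le_rfl
        rwa [hb'.right] at this
      · exact .inl hb'.right
    · obtain ⟨w, hw, hwy, hbw⟩ := hG.exists_lt hD hy (i := G.lev a + 1) (j := G.lev c) (by omega)
        (by omega) hby hbc' h.right_mem
      refine ⟨w, hw, hbw, {z | G.Lt z y}, fun z hz => .inr hz,
        hG.conn_below (by omega) hcy hby hwy (hbw.mono fun z hz => ⟨hz, ?_⟩)⟩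
      rintro rfl
      have := hz.2; omega
  obtain ⟨Z, hZ, hwb⟩ := hwb
  -- Both `v` and `c` are attached to the component of `b i`, and they are joined outside it through
  -- `w`, because `D` misses the component. The forest property gives `v = c`, and `v` is `y` or
  -- beneath `y`.
  obtain ⟨k, v, h1, h2, h3, h4, h5⟩ := hwb.last_exit hbK (hK w hw)
  obtain ⟨hvl, hup⟩ := comp_exit h1 h5.left_mem.1.1 h3 h4
  have c1 : G.Conn (G.Band (G.lev a + 1) (G.lev c) \
      G.Comp (G.lev a + 1) (G.lev c - 1) (b i)) v w := h5.mono fun x hx => ⟨hx.1.1, hx.2⟩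
  have hcr' : G.lev c ≤ G.rank := by omega
  have c2 : G.Conn (G.Band (G.lev a + 1) (G.lev c) \
      G.Comp (G.lev a + 1) (G.lev c - 1) (b i)) c w :=
    (hD.conn _ _ (by omega) hcr' c h.right_mem w hw ((conn_symm hbc').trans hbw)).mono
      fun x hx => ⟨hx.1, hK x hx.2⟩
  have hvc := hG.eq_of_conn_diff_comp (by omega) h1 hcK hup hcup hvl (c1.trans (conn_symm c2))
  subst hvc
  exact (hZ h5.left_mem.1.2).resolve_left hc

theorem eq_or_gt (hG : G.SimplyConnected) (hD : G.Nice D) (h : G.FreePath D a c b) {i : ℤ}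
    (hi : G.lev a < i) (hi' : i < G.lev c) {y : V} (hy : y ∈ D) (hby : G.Lt y (b i)) :
    a = y ∨ G.Lt y a := by
  have := h.dual.eq_or_lt hG.dual hD.dual (i := G.rank - i) (by rw [dual_lev]; omega)
    (by rw [dual_lev]; omega) hy (dual_lt.2 (by rwa [sub_sub_cancel]))
  rwa [dual_lt] at this

/-- The edges between `D` and the inner vertices of a free path are the two obvious ones. -/
theorem adj_iff (hG : G.SimplyConnected) (hD : G.Nice D) (h : G.FreePath D a c b) {i : ℤ}
    (hi : G.lev a < i) (hi' : i < G.lev c) {y : V} (hy : y ∈ D) :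
    G.adj (b i) y ↔ (i + 1 = G.lev c ∧ y = c) ∨ (i = G.lev a + 1 ∧ y = a) := by
  have hbl := h.lev_eq hi hi'
  constructor
  · intro hadj
    rcases up_or_up hadj with hup | hup
    · left
      have h1 := hup.2
      rcases h.eq_or_lt hG hD hi hi' hy hup.lt with rfl | h2
      · exact ⟨by omega, rfl⟩
      · have := h2.lev_lt; omega
    · right
      have h1 := hup.2
      rcases h.eq_or_gt hG hD hi hi' hy hup.lt with rfl | h2
      · exact ⟨by omega, rfl⟩
      · have := h2.lev_lt; omega
  · rintro (⟨h1, rfl⟩ | ⟨h1, rfl⟩)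
    · have := h.isPath.up i hi.le hi'
      rw [h1, h.isPath.right] at this
      exact this.adj
    · have := h.isPath.up (G.lev y) le_rfl (by omega)
      rw [← h1, h.isPath.left] at this
      exact this.adj'

theorem path_mem (h : G.FreePath D a c b) {i : ℤ} (hi : G.lev a ≤ i) (hi' : i ≤ G.lev c) :
    b i ∈ G.adjoin D a c b := by
  rcases hi.eq_or_lt with rfl | hi
  · rw [h.isPath.left]; exact .inl h.left_mem
  rcases hi'.eq_or_lt with rfl | hi'
  · rw [h.isPath.right]; exact .inl h.right_mem
  exact .inr ⟨i, hi, hi', rfl⟩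

theorem transGen (h : G.FreePath D a c b) {i j : ℤ} (hi : G.lev a ≤ i) (hij : i < j)
    (hj : j ≤ G.lev c) :
    TransGen (fun x y => G.Up x y ∧ x ∈ G.adjoin D a c b ∧ y ∈ G.adjoin D a c b) (b i) (b j) := by
  induction j, hij using Int.leInduction with
  | base => exact .single ⟨h.isPath.up i hi (by omega), h.path_mem hi (by omega),
      h.path_mem (by omega) (by omega)⟩
  | succ j hij ih => exact (ih (by omega)).tail ⟨h.isPath.up j (by omega) (by omega),
      h.path_mem (by omega) (by omega), h.path_mem (by omega) (by omega)⟩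

/-- An inner vertex of a free path connected in a band to a vertex of `D` is connected to it in the
enlarged set. -/
theorem conn_adjoin (hD : G.Nice D) (h : G.FreePath D a c b) {i : ℤ}
    (hi : G.lev a < i) (hi' : i < G.lev c) {y : V} (hy : y ∈ D) {k l : ℤ} (hk : 0 ≤ k)
    (hl : l ≤ G.rank) (hc : G.Conn (G.Band k l) (b i) y) :
    G.Conn (G.Band k l ∩ G.adjoin D a c b) (b i) y := by
  have hbl := h.lev_eq hi hi'
  have hki := hc.left_mem.1
  have hil := hc.left_mem.2
  have hsub : ∀ i j : ℤ, G.lev a ≤ i → k ≤ i → j ≤ l → j ≤ G.lev c →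
      {z | ∃ m, i ≤ m ∧ m ≤ j ∧ b m = z} ⊆ G.Band k l ∩ G.adjoin D a c b := by
    rintro i j h1 h2 h3 h4 z ⟨m, h5, h6, rfl⟩
    have := h.isPath.lev_eq (i := m) (by omega) (by omega)
    exact ⟨⟨by omega, by omega⟩, h.path_mem (by omega) (by omega)⟩
  have hsub' : G.Band k l ∩ D ⊆ G.Band k l ∩ G.adjoin D a c b := fun z hz => ⟨hz.1, .inl hz.2⟩
  -- If the band contains the level of `a` or of `c`, the path leads to this vertex of `D` within
  -- the band, and niceness of `D` does the rest. If not, the band lies in the open one, where a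
  -- free path is not connected to `D`.
  by_cases hka : k ≤ G.lev a
  · have h1 := (h.isPath.conn le_rfl hi.le hi'.le).mono (hsub _ _ le_rfl hka (by omega) hi'.le)
    rw [h.isPath.left] at h1
    have h2 := (hD.conn k l hk hl a h.left_mem y hy
      ((h1.mono Set.inter_subset_left).trans hc)).mono hsub'
    exact (conn_symm h1).trans h2
  by_cases hlc : G.lev c ≤ l
  · have h1 := (h.isPath.conn hi.le hi'.le le_rfl).mono (hsub _ _ hi.le (by omega) hlc le_rfl)
    rw [h.isPath.right] at h1
    have h2 := (hD.conn k l hk hl c h.right_mem y hy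
      ((conn_symm (h1.mono Set.inter_subset_left)).trans hc)).mono hsub'
    exact h1.trans h2
  · exact absurd (hc.mono (band_mono (by omega) (by omega))) (h.free i hi hi' y hy)

/-- A nice set remains nice if the inner vertices of a free path are added. -/
theorem nice_adjoin (hG : G.SimplyConnected) (hD : G.Nice D) (h : G.FreePath D a c b) :
    G.Nice (G.adjoin D a c b) where
  bot_mem := .inl hD.bot_mem
  top_mem := .inl hD.top_mem
  path := by
    have sub : ∀ x ∈ D, ∀ y ∈ D, G.Lt x y →
        TransGen (fun x y => G.Up x y ∧ x ∈ G.adjoin D a c b ∧ y ∈ G.adjoin D a c b) x y :=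
      fun x hx y hy hxy => TransGen.mono (fun _ _ hh => ⟨hh.1, .inl hh.2.1, .inl hh.2.2⟩) _ _
        (hD.path x hx y hy hxy)
    rintro x (hx | ⟨i, hi, hi', rfl⟩) y (hy | ⟨j, hj, hj', rfl⟩) hxy
    · exact sub x hx y hy hxy
    · have h1 := h.transGen le_rfl hj hj'.le
      rw [h.isPath.left] at h1
      -- Every ascent from `D` to an inner vertex can be rerouted through `a`.
      rcases h.eq_or_gt hG hD hj hj' hx hxy with rfl | h2
      · exact h1
      · exact (sub x hx a h.left_mem h2).trans h1
    · have h1 := h.transGen hi.le hi' le_rfl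
      rw [h.isPath.right] at h1
      rcases h.eq_or_lt hG hD hi hi' hy hxy with rfl | h2
      · exact h1
      · exact h1.trans (sub c h.right_mem y hy h2)
    · have h1 := hxy.lev_lt
      rw [h.lev_eq hi hi', h.lev_eq hj hj'] at h1
      exact h.transGen hi.le h1 hj'.le
  conn := by
    rintro k l hk hl x (hx | ⟨i, hi, hi', rfl⟩) y (hy | ⟨j, hj, hj', rfl⟩) hxy
    · exact (hD.conn k l hk hl x hx y hy hxy).mono fun z hz => ⟨hz.1, .inl hz.2⟩
    · exact conn_symm (h.conn_adjoin hD hj hj' hx hk hl (conn_symm hxy))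
    · exact h.conn_adjoin hD hi hi' hy hk hl hxy
    · have hbi := h.lev_eq hi hi'
      have hbj := h.lev_eq hj hj'
      have key : ∀ i j, i ≤ j → G.lev a < i → j < G.lev c → k ≤ i → j ≤ l →
          G.Conn (G.Band k l ∩ G.adjoin D a c b) (b i) (b j) := by
        intro i j hij hi hj hk hl
        refine (h.isPath.conn hi.le hij hj.le).mono ?_
        rintro z ⟨m, h5, h6, rfl⟩
        have := h.isPath.lev_eq (i := m) (by omega) (by omega)
        exact ⟨⟨by omega, by omega⟩, h.path_mem (by omega) (by omega)⟩
      have h1 := hxy.left_mem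
      have h2 := hxy.right_mem
      simp only [Band, Set.mem_ofPred_eq, hbi, hbj] at h1 h2
      rcases le_total i j with hij | hij
      · exact key i j hij hi hj' h1.1 h2.2
      · exact conn_symm (key j i hij hj hi' h2.1 h1.2)

end FreePath

/-- `D'` arises from `D` by successively adding the inner vertices of finitely many free paths. -/
inductive Reach (G : LeveledGraph V) (D : Set V) : Set V → Prop
  | refl : Reach G D D
  | step {D' : Set V} {a c : V} {b : ℤ → V} : Reach G D D' → G.FreePath D' a c b →
      Reach G D (G.adjoin D' a c b)

namespace Reach

variable {D D' D'' : Set V}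

theorem trans (h : G.Reach D D') (h' : G.Reach D' D'') : G.Reach D D'' := by
  induction h' with
  | refl => exact h
  | step _ hf ih => exact ih.step hf

theorem subset (h : G.Reach D D') : D ⊆ D' := by
  induction h with
  | refl => exact subset_rfl
  | step _ _ ih => exact ih.trans subset_adjoin

theorem nice (hG : G.SimplyConnected) (hD : G.Nice D) (h : G.Reach D D') : G.Nice D' := by
  induction h with
  | refl => exact hD
  | step _ hf ih => exact hf.nice_adjoin hG ih

end Reach

/-- Every vertex between two vertices of a nice set `D` is reached from `D`. -/
theorem SimplyConnected.exists_reach_between (hG : G.SimplyConnected) (n : ℕ) {D : Set V}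
    (hD : G.Nice D) {a c p : V} (ha : a ∈ D) (hc : c ∈ D) (hn : G.lev c ≤ G.lev a + n)
    (hp : p ∈ G.Between a c) : ∃ D', G.Reach D D' ∧ p ∈ D' := by
  induction n using Nat.strong_induction_on generalizing D a c p with
  | _ n ih =>
    have h1 := hp.1.lev_lt
    have h2 := hp.2.lev_lt
    have h3 := G.neg_one_le_lev a
    have h4 := G.lev_le c
    have hpB : p ∈ G.Band (G.lev a + 1) (G.lev c - 1) := ⟨by omega, by omega⟩
    by_cases hd : ∃ d ∈ D, G.Conn (G.Band (G.lev a + 1) (G.lev c - 1)) p d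
    · obtain ⟨d, hd, hpd⟩ := hd
      obtain ⟨e, he, heB, hpe⟩ := hG.exists_between hD ha hc hp hd hpd
      have hcon : G.Conn (G.Band (G.lev a + 1) (G.lev c - 1) ∩ G.Between a c) p e := by
        refine hG.sc a c p e _ _ (hp.1.trans hp.2) (by omega) (by omega) hp heB
          (hpe.mono fun z hz => ⟨hz, ?_, ?_⟩)
        · rintro rfl
          have := hz.1; omega
        · rintro rfl
          have := hz.2; omega
      obtain ⟨m, hm⟩ := hcon
      -- Induction along the walk, from its end `e ∈ D` back to `p`. Once `y` is reached, its
      -- neighbour `x` lies between `a` and `y` or between `y` and `c`, where the gap of levels is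
      -- smaller.
      induction hm with
      | nil => exact ⟨D, .refl, he⟩
      | @cons m x y z hx hxy hw ihw =>
        have hyB := hw.left_mem
        have := hyB.2.1.lev_lt; have := hyB.2.2.lev_lt
        obtain ⟨D₁, hD₁, hy⟩ := ihw hyB.2 hyB.2.1.lev_lt hyB.2.2.lev_lt hyB.1
          (ConnIn.trans (.single hyB.1 hx.1 (G.adj_symm _ _ hxy)) hpd) he heB
          (ConnIn.trans (.single hyB.1 hx.1 (G.adj_symm _ _ hxy)) hpe)
        have hnice := hD₁.nice hG hD
        obtain ⟨n', rfl⟩ : ∃ n', n = n' + 1 := ⟨n - 1, by omega⟩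
        rcases up_or_up hxy with hup | hup
        · have := hup.2
          obtain ⟨D₂, hD₂, hx'⟩ := ih n' n'.lt_succ_self hnice (hD₁.subset ha) hy
            (by push_cast at hn; omega) (p := x) ⟨hp.1, hup.lt⟩
          exact ⟨D₂, hD₁.trans hD₂, hx'⟩
        · have := hup.2
          obtain ⟨D₂, hD₂, hx'⟩ := ih n' n'.lt_succ_self hnice hy (hD₁.subset hc)
            (by push_cast at hn; omega) (p := x) ⟨hup.lt, hp.2⟩
          exact ⟨D₂, hD₁.trans hD₂, hx'⟩
    · push Not at hd
      -- All inner vertices of a path through `p` are connected to `p` in the open band. As the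
      -- component of `p` misses `D`, the path is free.
      obtain ⟨b, hb, hbp⟩ := exists_isPath_through hp.1 hp.2
      have hf : G.FreePath D a c b := by
        refine ⟨ha, hc, by omega, hb, fun i hi hi' d hdD hcon => hd d hdD (ConnIn.trans ?_ hcon)⟩
        have := hb.conn_band (i := G.lev p) (j := i) (k := G.lev a + 1) (l := G.lev c - 1)
          (by omega) (by omega) (by omega) (by omega) (by omega) (by omega) (by omega) (by omega)
        rwa [hbp] at this
      exact ⟨_, Reach.refl.step hf, .inr ⟨G.lev p, h1, h2, hbp⟩⟩

/-- Every actual vertex lies between the two imaginary ones, and these belong to every nice set. -/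
theorem SimplyConnected.exists_reach (hG : G.SimplyConnected) {D : Set V} (hD : G.Nice D) (p : V) :
    ∃ D', G.Reach D D' ∧ p ∈ D' := by
  by_cases hb : p = G.bot
  · exact ⟨D, .refl, hb ▸ hD.bot_mem⟩
  by_cases ht : p = G.top
  · exact ⟨D, .refl, ht ▸ hD.top_mem⟩
  have := G.rank_nonneg
  exact hG.exists_reach_between (G.rank + 2).toNat hD hD.bot_mem hD.top_mem
    (by rw [G.lev_top, G.lev_bot]; omega) ⟨hG.bot_lt p hb, hG.lt_top p ht⟩

end LeveledGraph

/-! ### Isomorphisms of nice sets, rich graphs, and the countable family of nice sets. -/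

/-- A countable set generates a countable set closed under a countably-valued binary operation. -/
theorem Set.Countable.exists_closed {α : Type*} {A : Set α} (hA : A.Countable) (F : α → α → Set α)
    (hF : ∀ x y, (F x y).Countable) :
    ∃ B, A ⊆ B ∧ B.Countable ∧ ∀ x ∈ B, ∀ y ∈ B, F x y ⊆ B := by
  let B : ℕ → Set α := fun n => Nat.rec A (fun _ S => S ∪ ⋃ x ∈ S, ⋃ y ∈ S, F x y) n
  have hsucc : ∀ n, B (n + 1) = B n ∪ ⋃ x ∈ B n, ⋃ y ∈ B n, F x y := fun n => rfl
  have hmono : Monotone B := monotone_nat_of_le_succ fun n => by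
    rw [hsucc]; exact Set.subset_union_left
  refine ⟨⋃ n, B n, Set.subset_iUnion B 0, Set.countable_iUnion fun n => ?_, ?_⟩
  · induction n with
    | zero => exact hA
    | succ n ih =>
      rw [hsucc]
      exact ih.union (ih.biUnion fun x _ => ih.biUnion fun y _ => hF x y)
  · intro x hx y hy
    obtain ⟨m, hm⟩ := Set.mem_iUnion.1 hx
    obtain ⟨n, hn⟩ := Set.mem_iUnion.1 hy
    refine Set.Subset.trans ?_ (Set.subset_iUnion B (max m n + 1))
    rw [hsucc]
    refine Set.Subset.trans ?_ Set.subset_union_right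
    intro z hz
    simp only [Set.mem_iUnion]
    exact ⟨x, hmono (le_max_left m n) hm, y, hmono (le_max_right m n) hn, hz⟩

namespace LeveledGraph

open Relation

variable {V : Type*} {G : LeveledGraph V}

/-- The map `g` is an isomorphism between the sets of vertices `D` and `E`. -/
structure IsIso (G : LeveledGraph V) (D E : Set V) (g : V → V) : Prop where
  bijOn : Set.BijOn g D E
  lev_eq : ∀ x ∈ D, G.lev (g x) = G.lev x
  adj_iff : ∀ x ∈ D, ∀ y ∈ D, G.adj (g x) (g y) ↔ G.adj x y

namespace IsIso

variable {D E : Set V} {g : V → V}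

theorem refl : G.IsIso D D id := ⟨Set.bijOn_id D, fun _ _ => rfl, fun _ _ _ _ => Iff.rfl⟩

theorem symm (h : G.IsIso D E g) : ∃ g', G.IsIso E D g' ∧ (∀ x ∈ D, g' (g x) = x) := by
  have : Nonempty V := ⟨G.bot⟩
  have hinv := h.bijOn.invOn_invFunOn
  have hbij := hinv.symm.bijOn h.bijOn.surjOn.mapsTo_invFunOn h.bijOn.mapsTo
  refine ⟨Function.invFunOn g D, ⟨hbij, fun x hx => ?_, fun x hx y hy => ?_⟩,
    fun x hx => hinv.1 hx⟩
  · rw [← h.lev_eq _ (hbij.mapsTo hx), hinv.2 hx]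
  · rw [← h.adj_iff _ (hbij.mapsTo hx) _ (hbij.mapsTo hy), hinv.2 hx, hinv.2 hy]

theorem countable (h : G.IsIso D E g) (hE : E.Countable) : D.Countable := by
  obtain ⟨g', hg', -⟩ := h.symm
  rw [← hg'.bijOn.image_eq]
  exact hE.image g'

/-- An isomorphism only sees edges inside `D`; niceness puts a witnessing path there. -/
theorem lt (hD : G.Nice D) (h : G.IsIso D E g) {x y : V} (hx : x ∈ D) (hy : y ∈ D)
    (hxy : G.Lt x y) : G.Lt (g x) (g y) := by
  refine TransGen.lift g (fun u v huv => ?_) _ _ (hD.path x hx y hy hxy)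
  obtain ⟨hup, hu, hv⟩ := huv
  refine ⟨(h.adj_iff u hu v hv).2 hup.1, ?_⟩
  rw [h.lev_eq u hu, h.lev_eq v hv, hup.2]

/-- An isomorphism of nice sets extends to corresponding free paths. -/
theorem exists_adjoin (hG : G.SimplyConnected) (hD : G.Nice D) (hE : G.Nice E)
    (h : G.IsIso D E g) {a c : V} {b b' : ℤ → V} (hb : G.FreePath D a c b)
    (hb' : G.FreePath E (g a) (g c) b') :
    ∃ g', G.IsIso (G.adjoin D a c b) (G.adjoin E (g a) (g c) b') g' ∧ Set.EqOn g' g D := by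
  classical
  have hla := h.lev_eq a hb.left_mem
  have hlc := h.lev_eq c hb.right_mem
  let g' : V → V := fun x => if ∃ i, G.lev a < i ∧ i < G.lev c ∧ b i = x then b' (G.lev x) else g x
  have hgD : ∀ x ∈ D, g' x = g x := by
    intro x hx
    refine if_neg ?_
    rintro ⟨i, hi, hi', rfl⟩
    exact hb.notMem hi hi' hx
  have hgb : ∀ i, G.lev a < i → i < G.lev c → g' (b i) = b' i := by
    intro i hi hi'
    have : g' (b i) = b' (G.lev (b i)) := if_pos ⟨i, hi, hi', rfl⟩
    rw [this, hb.lev_eq hi hi']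
  have hlb' : ∀ i, G.lev a < i → i < G.lev c → G.lev (b' i) = i := fun i hi hi' =>
    hb'.lev_eq (by omega) (by omega)
  have hnb' : ∀ i, G.lev a < i → i < G.lev c → ∀ x ∈ D, b' i ≠ g x := by
    intro i hi hi' x hx heq
    exact hb'.notMem (i := i) (by omega) (by omega) (heq ▸ h.bijOn.mapsTo hx)
  -- By `FreePath.adj_iff` the edges between a free path and the nice set are determined by the
  -- endpoints, on both sides.
  have hadj : ∀ i, G.lev a < i → i < G.lev c → ∀ y ∈ D,
      (G.adj (b' i) (g y) ↔ G.adj (b i) y) := by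
    intro i hi hi' y hy
    rw [hb.adj_iff hG hD hi hi' hy, hb'.adj_iff hG hE (by omega) (by omega) (h.bijOn.mapsTo hy),
      hla, hlc, h.bijOn.injOn.eq_iff hy hb.right_mem, h.bijOn.injOn.eq_iff hy hb.left_mem]
  have hbb : ∀ {a c : V} {b : ℤ → V}, G.IsPath a c b → ∀ i j, G.lev a < i → i < G.lev c →
      G.lev a < j → j < G.lev c → (G.adj (b i) (b j) ↔ j = i + 1 ∨ i = j + 1) := by
    intro a c b hb i j hi hi' hj hj'
    constructor
    · intro hadj
      have := G.lev_of_adj _ _ hadj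
      rwa [hb.lev_eq hi.le hi'.le, hb.lev_eq hj.le hj'.le] at this
    · rintro (rfl | rfl)
      · exact (hb.up i hi.le hi').adj
      · exact (hb.up j hj.le hj').adj'
  refine ⟨g', ⟨⟨?_, ?_, ?_⟩, ?_, ?_⟩, hgD⟩
  · rintro x (hx | ⟨i, hi, hi', rfl⟩)
    · rw [hgD x hx]; exact .inl (h.bijOn.mapsTo hx)
    · rw [hgb i hi hi']; exact .inr ⟨i, by omega, by omega, rfl⟩
  · rintro x (hx | ⟨i, hi, hi', rfl⟩) y (hy | ⟨j, hj, hj', rfl⟩) hxy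
    · rw [hgD x hx, hgD y hy] at hxy
      exact h.bijOn.injOn hx hy hxy
    · rw [hgD x hx, hgb j hj hj'] at hxy
      exact absurd hxy.symm (hnb' j hj hj' x hx)
    · rw [hgD y hy, hgb i hi hi'] at hxy
      exact absurd hxy (hnb' i hi hi' y hy)
    · rw [hgb i hi hi', hgb j hj hj'] at hxy
      have := congrArg G.lev hxy
      rw [hlb' i hi hi', hlb' j hj hj'] at this
      rw [this]
  · rintro y (hy | ⟨i, hi, hi', rfl⟩)
    · obtain ⟨x, hx, rfl⟩ := h.bijOn.surjOn hy
      exact ⟨x, .inl hx, hgD x hx⟩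
    · exact ⟨b i, .inr ⟨i, by omega, by omega, rfl⟩, hgb i (by omega) (by omega)⟩
  · rintro x (hx | ⟨i, hi, hi', rfl⟩)
    · rw [hgD x hx, h.lev_eq x hx]
    · rw [hgb i hi hi', hb.lev_eq hi hi', hlb' i hi hi']
  · have comm : ∀ x y, G.adj x y ↔ G.adj y x := fun x y => ⟨G.adj_symm x y, G.adj_symm y x⟩
    rintro x (hx | ⟨i, hi, hi', rfl⟩) y (hy | ⟨j, hj, hj', rfl⟩)
    · rw [hgD x hx, hgD y hy, h.adj_iff x hx y hy]
    · rw [hgD x hx, hgb j hj hj', comm, hadj j hj hj' x hx, comm]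
    · rw [hgD y hy, hgb i hi hi', hadj i hi hi' y hy]
    · rw [hgb i hi hi', hgb j hj hj', hbb hb.isPath i j hi hi' hj hj',
        hbb hb'.isPath i j (by omega) (by omega) (by omega) (by omega)]

end IsIso

/-- Every pair of vertices is joined by a path avoiding, in the sense of infinite distance, a given
countable set. -/
def Rich (G : LeveledGraph V) : Prop :=
  ∀ A : Set V, A.Countable → ∀ a c, G.Lt a c → G.lev a + 2 ≤ G.lev c → ∃ b, G.IsPath a c b ∧
    ∀ i, G.lev a < i → i < G.lev c → ∀ d ∈ A,
      ¬ G.Conn (G.Band (G.lev a + 1) (G.lev c - 1)) (b i) d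

/-- A family of nice sets in which all possible types of extensions by free paths are present. -/
def RichFamily (G : LeveledGraph V) (F : Set (Set V)) : Prop :=
  ∀ E ∈ F, G.Nice E ∧ ∀ a ∈ E, ∀ c ∈ E, G.Lt a c → G.lev a + 2 ≤ G.lev c →
    ∃ b, G.FreePath E a c b ∧ G.adjoin E a c b ∈ F

theorem Rich.exists_freePath (hR : G.Rich) {E : Set V} (hE : E.Countable) {a c : V} (ha : a ∈ E)
    (hc : c ∈ E) (hac : G.Lt a c) (hgap : G.lev a + 2 ≤ G.lev c) : ∃ b, G.FreePath E a c b := by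
  obtain ⟨b, hb, hfree⟩ := hR E hE a c hac hgap
  exact ⟨b, ha, hc, hgap, hb, hfree⟩

/-- This family serves the back-and-forth argument; the countable one below serves to count types.
-/
theorem Rich.richFamily (hG : G.SimplyConnected) (hR : G.Rich) :
    G.RichFamily {E | G.Nice E ∧ E.Countable} := by
  rintro E ⟨hE, hEc⟩
  refine ⟨hE, fun a ha c hc hac hgap => ?_⟩
  obtain ⟨b, hb⟩ := hR.exists_freePath hEc ha hc hac hgap
  exact ⟨b, hb, hb.nice_adjoin hG hE, countable_adjoin hEc⟩

/-- One free path per pair of endpoints is enough, as all of them give isomorphic extensions.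
Closing `{D}` under one choice for every set and every pair therefore keeps the family countable. -/
theorem Rich.exists_countable_richFamily (hG : G.SimplyConnected) (hR : G.Rich) {D : Set V}
    (hD : G.Nice D) (hDc : D.Countable) :
    ∃ F : Set (Set V), D ∈ F ∧ F.Countable ∧ (∀ E ∈ F, E.Countable) ∧ G.RichFamily F := by
  classical
  let ext : Set V → V → V → Set V := fun E a c =>
    if h : ∃ b, G.FreePath E a c b then G.adjoin E a c h.choose else E
  -- The second argument is a dummy, present to fit `exists_closed`. The value at uncountable sets
  -- is empty so that all values are countable.
  let Φ : Set V → Set V → Set (Set V) := fun E _ =>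
    if E.Countable then ⋃ a ∈ E, ⋃ c ∈ E, {ext E a c} else ∅
  obtain ⟨B, hDB, hBc, hB⟩ := (Set.countable_singleton D).exists_closed Φ (fun E _ => by
    by_cases hE : E.Countable
    · simp only [Φ, hE, if_true]
      exact hE.biUnion fun a _ => hE.biUnion fun c _ => Set.countable_singleton _
    · simp only [Φ, hE, if_false]
      exact Set.countable_empty)
  refine ⟨{E ∈ B | G.Nice E ∧ E.Countable}, ⟨hDB rfl, hD, hDc⟩, hBc.mono fun E hE => hE.1,
    fun E hE => hE.2.2, ?_⟩
  rintro E ⟨hEB, hE, hEc⟩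
  refine ⟨hE, fun a ha c hc hac hgap => ?_⟩
  have hex := hR.exists_freePath hEc ha hc hac hgap
  refine ⟨hex.choose, hex.choose_spec, ?_, hex.choose_spec.nice_adjoin hG hE,
    countable_adjoin hEc⟩
  refine hB E hEB E hEB ?_
  simp only [Φ, hEc, if_true, Set.mem_iUnion]
  exact ⟨a, ha, c, hc, by simp only [ext, hex, dif_pos, Set.mem_singleton_iff]⟩

/-- The free paths that build `D'` are copied one by one by free paths between the images of their
endpoints. -/
theorem RichFamily.exists_isIso (hG : G.SimplyConnected) {F : Set (Set V)} (hF : G.RichFamily F)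
    {D D' E : Set V} {g : V → V} (hD : G.Nice D) (hE : E ∈ F) (hg : G.IsIso D E g)
    (hDD' : G.Reach D D') : ∃ E' ∈ F, ∃ g', G.IsIso D' E' g' ∧ Set.EqOn g' g D := by
  induction hDD' with
  | refl => exact ⟨E, hE, g, hg, fun _ _ => rfl⟩
  | @step D' a c b hDD' hf ih =>
    obtain ⟨E', hE', g', hg', heq⟩ := ih
    have hD' := hDD'.nice hG hD
    have hac : G.Lt a c := by
      have := hf.isPath.lt le_rfl (by have := hf.gap; omega) le_rfl
      rwa [hf.isPath.left, hf.isPath.right] at this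
    obtain ⟨hE'n, hext⟩ := hF E' hE'
    obtain ⟨b', hb', hmem⟩ := hext (g' a) (hg'.bijOn.mapsTo hf.left_mem) (g' c)
      (hg'.bijOn.mapsTo hf.right_mem) (hg'.lt hD' hf.left_mem hf.right_mem hac)
      (by rw [hg'.lev_eq a hf.left_mem, hg'.lev_eq c hf.right_mem]; exact hf.gap)
    obtain ⟨g'', hg'', heq'⟩ := hg'.exists_adjoin hG hD' hE'n hf hb'
    exact ⟨_, hmem, g'', hg'', fun x hx => (heq' (hDD'.subset hx)).trans (heq hx)⟩

/-- The forth property of the isomorphisms between countable nice sets. -/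
theorem Rich.exists_isIso_mem (hG : G.SimplyConnected) (hR : G.Rich) {D E : Set V} {g : V → V}
    (hD : G.Nice D) (hE : G.Nice E) (hEc : E.Countable) (hg : G.IsIso D E g) (p : V) :
    ∃ D' E' g', G.Nice D' ∧ G.Nice E' ∧ E'.Countable ∧ G.IsIso D' E' g' ∧ Set.EqOn g' g D ∧
      D ⊆ D' ∧ p ∈ D' := by
  obtain ⟨D', hDD', hp⟩ := hG.exists_reach hD p
  obtain ⟨E', ⟨hE', hE'c⟩, g', hg', heq⟩ :=
    (hR.richFamily hG).exists_isIso hG hD ⟨hE, hEc⟩ hg hDD'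
  exact ⟨D', E', g', hDD'.nice hG hD, hE', hE'c, hg', heq, hDD'.subset, hp⟩

/-- Each pair of vertices needs one path and, for each of countably many bands, one walk; close `A`
and the imaginary vertices under these witnesses. -/
theorem exists_countable_nice {A : Set V} (hA : A.Countable) :
    ∃ D, A ⊆ D ∧ D.Countable ∧ G.Nice D := by
  have key : ∀ x y, ∃ W : Set V, W.Countable ∧
      (G.Lt x y → TransGen (fun x y => G.Up x y ∧ x ∈ W ∧ y ∈ W) x y) ∧
      ∀ i j, G.Conn (G.Band i j) x y → G.Conn (G.Band i j ∩ W) x y := by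
    intro x y
    have h1 : ∃ W : Set V, W.Countable ∧
        (G.Lt x y → TransGen (fun x y => G.Up x y ∧ x ∈ W ∧ y ∈ W) x y) := by
      by_cases hxy : G.Lt x y
      · obtain ⟨b, hb⟩ := hxy.exists_isPath
        refine ⟨Set.range b, Set.countable_range b, fun _ => ?_⟩
        have : ∀ j, G.lev x + 1 ≤ j → j ≤ G.lev y → TransGen (fun x y => G.Up x y ∧
            x ∈ Set.range b ∧ y ∈ Set.range b) (b (G.lev x)) (b j) := by
          intro j hj
          induction j, hj using Int.leInduction with
          | base => exact fun h => .single ⟨hb.up _ le_rfl (by omega), ⟨_, rfl⟩, ⟨_, rfl⟩⟩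
          | succ j hj ih =>
            exact fun h => .tail (ih (by omega))
              ⟨hb.up j (by omega) (by omega), ⟨_, rfl⟩, ⟨_, rfl⟩⟩
        have := this (G.lev y) hxy.lev_lt le_rfl
        rwa [hb.left, hb.right] at this
      · exact ⟨∅, Set.countable_empty, fun h => absurd h hxy⟩
    have h2 : ∀ i j, ∃ W : Set V, W.Countable ∧
        (G.Conn (G.Band i j) x y → G.Conn (G.Band i j ∩ W) x y) := by
      intro i j
      by_cases hc : G.Conn (G.Band i j) x y
      · obtain ⟨n, hn⟩ := hc
        obtain ⟨z, h0, h1, h2, h3⟩ := walkIn_iff_exists_fin.1 hn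
        exact ⟨Set.range z, Set.countable_range z, fun _ => ⟨n, walkIn_iff_exists_fin.2
          ⟨z, h0, h1, h2, fun k => ⟨h3 k, k, rfl⟩⟩⟩⟩
      · exact ⟨∅, Set.countable_empty, fun h => absurd h hc⟩
    obtain ⟨W, hW, hW'⟩ := h1
    choose U hU hU' using h2
    refine ⟨W ∪ ⋃ i, ⋃ j, U i j, hW.union (Set.countable_iUnion fun i =>
      Set.countable_iUnion fun j => hU i j), fun h => ?_, fun i j h => (hU' i j h).mono ?_⟩
    · exact TransGen.mono (fun _ _ hh => ⟨hh.1, .inl hh.2.1, .inl hh.2.2⟩) _ _ (hW' h)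
    · rintro z ⟨hz, hz'⟩
      exact ⟨hz, .inr (Set.mem_iUnion.2 ⟨i, Set.mem_iUnion.2 ⟨j, hz'⟩⟩)⟩
  choose F hF hF1 hF2 using key
  obtain ⟨D, hAD, hDc, hD⟩ := ((hA.insert G.top).insert G.bot).exists_closed F hF
  refine ⟨D, fun x hx => hAD (.inr (.inr hx)), hDc, hAD (.inl rfl), hAD (.inr (.inl rfl)), ?_, ?_⟩
  · intro a ha c hc hac
    exact TransGen.mono (fun _ _ hh => ⟨hh.1, hD a ha c hc hh.2.1, hD a ha c hc hh.2.2⟩) _ _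
      (hF1 a c hac)
  · intro i j _ _ x hx y hy hc
    exact (hF2 x y i j hc).mono fun z hz => ⟨hz.1, hD x hx y hy hz.2⟩

theorem SimplyConnected.exists_reach_forall (hG : G.SimplyConnected) {D : Set V} (hD : G.Nice D)
    {n : ℕ} (p : Fin n → V) : ∃ D', G.Reach D D' ∧ ∀ i, p i ∈ D' := by
  induction n with
  | zero => exact ⟨D, .refl, fun i => i.elim0⟩
  | succ n ih =>
    obtain ⟨D', hD', hp⟩ := ih (fun i => p i.castSucc)
    obtain ⟨D'', hD'', hp'⟩ := hG.exists_reach (hD'.nice hG hD) (p (Fin.last n))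
    refine ⟨D'', hD'.trans hD'', fun i => ?_⟩
    induction i using Fin.lastCases with
    | last => exact hp'
    | cast i => exact hD''.subset (hp i)

/-- Up to isomorphism over a countable set `A`, there are only countably many finite tuples. -/
theorem Rich.exists_countable_isIso (hG : G.SimplyConnected) (hR : G.Rich) {A : Set V}
    (hA : A.Countable) : ∃ W : Set V, W.Countable ∧ ∀ (n : ℕ) (p : Fin n → V), ∃ D E g,
      G.Nice D ∧ G.Nice E ∧ E.Countable ∧ G.IsIso D E g ∧ A ⊆ D ∧
      (∀ x ∈ A, g x = x) ∧ (∀ i, p i ∈ D) ∧ ∀ i, g (p i) ∈ W := by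
  obtain ⟨D₀, hAD, hDc, hD₀⟩ := exists_countable_nice (G := G) hA
  obtain ⟨F, hDF, hFc, hFc', hF⟩ := hR.exists_countable_richFamily hG hD₀ hDc
  refine ⟨⋃₀ F, hFc.sUnion hFc', fun n p => ?_⟩
  obtain ⟨D, hD, hp⟩ := hG.exists_reach_forall hD₀ p
  obtain ⟨E, hE, g, hg, heq⟩ := hF.exists_isIso hG hD₀ hDF .refl hD
  exact ⟨D, E, g, hD.nice hG hD₀, (hF E hE).1, hFc' E hE, hg, hAD.trans hD.subset,
    fun x hx => heq (hAD hx), hp, fun i => ⟨E, hE, hg.bijOn.mapsTo (hp i)⟩⟩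

end LeveledGraph

/-! ### Semantics of the formulas, and the leveled graph of a colored space. -/

namespace Pseudospace

open FirstOrder.Language FirstOrder.Language.Structure

/-- The vertices of a colored space together with the two imaginary vertices. -/
inductive Point (K : Type w) : Type w
  | bot : Point K
  | of (x : K) : Point K
  | top : Point K

/-- The point denoted by a vertex expression. -/
def Vertex.eval {K : Type w} {α : Type} (s : α → K) : Vertex α → Point K
  | .bot => .bot
  | .var x => .of (s x)
  | .top => .top

theorem Vertex.eval_var {K : Type w} {α : Type} (s : α → K) (x : α) :
    (Vertex.var x).eval s = .of (s x) := rfl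

theorem Vertex.eval_map {K : Type w} {α β : Type} (f : α → β) (t : β → K) (a : Vertex α) :
    (a.map f).eval t = a.eval (t ∘ f) := by
  cases a <;> rfl

section Semantics

variable (N : ℕ) {K : Type w} [(Pseudospace.language N).Structure K]

/-- `x` has level `i`. -/
def HasLevel (i : ℤ) (x : K) : Prop :=
  ∃ h : 0 ≤ i ∧ i ≤ N, RelMap (levelSymbol (N := N) ⟨i.toNat, by omega⟩) ![x]

/-- `x` and `y` are linked. -/
def Linked (x y : K) : Prop := RelMap (edgeSymbol N) ![x, y]

/-- The levels, extended to the imaginary vertices. -/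
def Point.HasLevel (i : ℤ) : Point K → Prop
  | .bot => i = -1
  | .of x => Pseudospace.HasLevel N i x
  | .top => i = N + 1

/-- The links, extended to the imaginary vertices. -/
def Point.Linked : Point K → Point K → Prop
  | .of x, .of y => Pseudospace.Linked N x y
  | .bot, .of x => Pseudospace.HasLevel N 0 x
  | .of x, .bot => Pseudospace.HasLevel N 0 x
  | .top, .of x => Pseudospace.HasLevel N N x
  | .of x, .top => Pseudospace.HasLevel N N x
  | _, _ => False

variable {N} {α : Type} {s : α → K}

theorem realize_levelF {i : ℤ} {a : Vertex α} :
    (levelF N i a).Realize s ↔ (a.eval s).HasLevel N i := by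
  cases a with
  | bot => by_cases h : i = -1 <;> simp [levelF, Vertex.eval, Point.HasLevel, h]
  | var x =>
    by_cases h : 0 ≤ i ∧ i ≤ N
    · simp only [levelF, Vertex.eval, Point.HasLevel, HasLevel, h, and_self, dif_pos,
        Formula.realize_rel₁, Term.realize_var, exists_true_left]
    · simp [levelF, Vertex.eval, Point.HasLevel, HasLevel, h]
  | top => by_cases h : i = N + 1 <;> simp [levelF, Vertex.eval, Point.HasLevel, h]

theorem realize_edgeF {a b : Vertex α} :
    (edgeF N a b).Realize s ↔ (a.eval s).Linked N (b.eval s) := by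
  cases a <;> cases b <;>
    simp [edgeF, realize_levelF, Vertex.eval, Point.HasLevel, Point.Linked, Linked,
      Formula.realize_rel₂]

theorem realize_levelInF {c d : ℤ} {x : α} :
    (levelInF N c d x).Realize s ↔ ∃ i, c ≤ i ∧ i ≤ d ∧ HasLevel N i (s x) := by
  simp only [levelInF, Formula.realize_iSup, realize_levelF, Vertex.eval, Point.HasLevel]
  constructor
  · rintro ⟨⟨i, h⟩, hi⟩; exact ⟨i, h.1, h.2, hi⟩
  · rintro ⟨i, h1, h2, hi⟩; exact ⟨⟨i, h1, h2⟩, hi⟩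

theorem realize_neF {x : α} {a : Vertex α} :
    (neF N x a).Realize s ↔ Point.of (s x) ≠ a.eval s := by
  cases a <;> simp [neF, eqF, Vertex.eval, Formula.realize_equal]

theorem realize_pathF {k : ℕ} {x y : α}
    {P : Fin (k + 1) → (Pseudospace.language N).Formula (α ⊕ Fin (k + 1))} :
    (pathF N k x y P).Realize s ↔ ∃ z : Fin (k + 1) → K, z 0 = s x ∧ z (Fin.last k) = s y ∧
      (∀ j : Fin k, Linked N (z j.castSucc) (z j.succ)) ∧
      ∀ j, (P j).Realize (Sum.elim s z) := by
  simp only [pathF, Formula.realize_iExs, Formula.realize_inf, Formula.realize_iInf, realize_edgeF,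
    eqF, Formula.realize_equal, Term.realize_var, Sum.elim_inr, Sum.elim_inl, Vertex.eval,
    Point.Linked, and_assoc]

theorem realize_allF [Finite α] {φ : (Pseudospace.language N).Formula α} :
    K ⊨ allF N φ ↔ ∀ s : α → K, φ.Realize s := by
  simp only [Sentence.Realize, allF, Formula.realize_iAlls, Formula.realize_relabel,
    Sum.elim_comp_inr]

end Semantics

section Graph

variable (N : ℕ) (K : Type w) [(Pseudospace.language N).Structure K]

/-- The axioms of colored spaces, semantically. -/
structure IsColoredSpace : Prop where
  exists_level : ∀ x : K, ∃ i, HasLevel N i x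
  level_unique : ∀ (x : K) i j, HasLevel N i x → HasLevel N j x → i = j
  symm : ∀ x y : K, Linked N x y → Linked N y x
  linked : ∀ (x y : K) i, HasLevel N i x → Linked N x y →
    HasLevel N (i - 1) y ∨ HasLevel N (i + 1) y

variable {N K}

theorem isColoredSpace (hK : K ⊨ coloredSpace N) : IsColoredSpace N K := by
  have h : ∀ φ ∈ coloredSpace N, K ⊨ φ := fun φ hφ => hK.realize_of_mem φ hφ
  refine ⟨fun x => ?_, fun x i j hi hj => ?_, fun x y hxy => ?_, fun x y i hi hxy => ?_⟩
  · have := realize_allF.1 (h _ (.inl (.inl (.inl rfl)))) (fun _ => x)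
    obtain ⟨i, -, -, hi⟩ := realize_levelInF.1 this
    exact ⟨i, hi⟩
  · by_contra hij
    have := realize_allF.1 (h _ (.inl (.inr ⟨i, j, hij, rfl⟩))) (fun _ => x)
    simp only [Formula.realize_not, Formula.realize_inf, realize_levelF] at this
    exact this ⟨hi, hj⟩
  · have := realize_allF.1 (h _ (.inl (.inl (.inr rfl)))) ![x, y]
    simp only [Formula.realize_imp, realize_edgeF] at this
    exact this hxy
  · have hi' := hi.choose
    have := realize_allF.1 (h _ (.inr ⟨i, hi'.1, hi'.2, rfl⟩)) ![x, y]
    simp only [Formula.realize_imp, Formula.realize_inf, Formula.realize_sup, realize_edgeF,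
      realize_levelF] at this
    exact this ⟨hi, hxy⟩

namespace IsColoredSpace

variable (h : IsColoredSpace N K)

/-- The level of a point. -/
noncomputable def lev : Point K → ℤ
  | .bot => -1
  | .of x => (h.exists_level x).choose
  | .top => N + 1

theorem hasLevel_iff {i : ℤ} {p : Point K} : p.HasLevel N i ↔ h.lev p = i := by
  cases p with
  | bot => exact eq_comm
  | of x =>
    have hx := (h.exists_level x).choose_spec
    exact ⟨fun hi => h.level_unique x _ _ hx hi, fun hi => hi ▸ hx⟩
  | top => exact eq_comm

theorem hasLevel_of_iff {i : ℤ} {x : K} : HasLevel N i x ↔ h.lev (.of x) = i :=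
  h.hasLevel_iff (p := .of x)

theorem lev_of (x : K) : 0 ≤ h.lev (.of x) ∧ h.lev (.of x) ≤ N :=
  (h.hasLevel_of_iff.2 rfl).choose

/-- The graph of all points. -/
noncomputable def graph : LeveledGraph (Point K) where
  rank := N
  lev := h.lev
  adj := Point.Linked N
  bot := .bot
  top := .top
  rank_nonneg := by omega
  adj_symm x y hxy := by
    cases x <;> cases y <;> first | exact hxy | exact h.symm _ _ hxy
  lev_of_adj x y hxy := by
    have hb : h.lev Point.bot = -1 := rfl
    have ht : h.lev Point.top = N + 1 := rfl
    cases x <;> cases y <;> simp only [Point.Linked, h.hasLevel_of_iff] at hxy <;> try omega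
    have := h.linked _ _ _ (h.hasLevel_of_iff.2 rfl) hxy
    simp only [h.hasLevel_of_iff] at this
    omega
  neg_one_le_lev x := by
    cases x with
    | bot => exact le_rfl
    | of x => have := h.lev_of x; omega
    | top => simp only [lev]; omega
  lev_le x := by
    cases x with
    | bot => simp only [lev]; omega
    | of x => have := h.lev_of x; omega
    | top => exact le_rfl
  lev_bot := rfl
  lev_top := rfl
  eq_bot x hx := by
    cases x with
    | bot => rfl
    | of x => have := h.lev_of x; omega
    | top => simp only [lev] at hx; omega
  eq_top x hx := by
    cases x with
    | bot => simp only [lev] at hx; omega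
    | of x => have := h.lev_of x; omega
    | top => rfl

theorem exists_of {p : Point K} (hp : 0 ≤ h.graph.lev p) (hp' : h.graph.lev p ≤ N) :
    ∃ x, p = .of x := by
  cases p with
  | bot => exact absurd hp (by simp [graph, lev])
  | of x => exact ⟨x, rfl⟩
  | top => exact absurd hp' (by simp [graph, lev])

theorem graph_lev : h.graph.lev = h.lev := rfl

theorem graph_adj_of {x y : K} : h.graph.adj (.of x) (.of y) ↔ Linked N x y := Iff.rfl

end IsColoredSpace

end Graph

end Pseudospace

theorem Relation.transGen_of_fin {V : Type*} {r : V → V → Prop} {k : ℕ} (hk : 0 < k)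
    (z : Fin (k + 1) → V) (hz : ∀ j : Fin k, r (z j.castSucc) (z j.succ)) :
    Relation.TransGen r (z 0) (z (Fin.last k)) := by
  induction k with
  | zero => omega
  | succ k ih =>
    have hlast := hz (Fin.last k)
    rw [Fin.succ_last] at hlast
    rcases Nat.eq_zero_or_pos k with rfl | hk'
    · exact .single hlast
    · exact (ih hk' (fun j => z j.castSucc) fun j => hz j.castSucc).tail hlast

namespace Pseudospace

open FirstOrder.Language FirstOrder.Language.Structure

variable {N : ℕ} {K : Type w} [(Pseudospace.language N).Structure K]

/-- The value of the variable matters only for an actual vertex, hence the conditional form of `hx`.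
-/
theorem eval_vertexAt {α : Type} {s : α → K} (h : IsColoredSpace N K) {p : Point K} {i : ℤ}
    {x : α} (hp : h.graph.lev p = i) (hx : ∀ y, p = .of y → s x = y) :
    (vertexAt N i x).eval s = p := by
  subst hp
  cases p with
  | bot => simp [vertexAt, IsColoredSpace.graph, IsColoredSpace.lev, Vertex.eval]
  | of y =>
    have := h.lev_of y
    have h1 : h.graph.lev (.of y) ≠ -1 := by rw [h.graph_lev]; omega
    have h2 : h.graph.lev (.of y) ≠ N + 1 := by rw [h.graph_lev]; omega
    simp [vertexAt, Vertex.eval, h1, h2, hx y rfl]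
  | top =>
    have h1 : (N : ℤ) + 1 ≠ -1 := by omega
    simp [vertexAt, IsColoredSpace.graph, IsColoredSpace.lev, Vertex.eval, h1]

namespace IsColoredSpace

variable (h : IsColoredSpace N K)

theorem walkIn_iff {S : Set (Point K)} (hS : ∀ p ∈ S, ∃ x, p = .of x) {k : ℕ} {x y : K} :
    WalkIn h.graph.adj S k (.of x) (.of y) ↔ ∃ z : Fin (k + 1) → K, z 0 = x ∧
      z (Fin.last k) = y ∧ (∀ j : Fin k, Linked N (z j.castSucc) (z j.succ)) ∧
      ∀ j, Point.of (z j) ∈ S := by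
  rw [walkIn_iff_exists_fin]
  constructor
  · rintro ⟨z, h0, h1, h2, h3⟩
    choose z' hz' using fun j => hS _ (h3 j)
    obtain rfl : z = fun j => .of (z' j) := funext hz'
    exact ⟨z', Point.of.inj h0, Point.of.inj h1, h2, h3⟩
  · rintro ⟨z, rfl, rfl, h2, h3⟩
    exact ⟨fun j => .of (z j), rfl, rfl, h2, h3⟩

theorem mem_band_iff {c d : ℤ} {x : K} :
    Point.of x ∈ h.graph.Band c d ↔ ∃ i, c ≤ i ∧ i ≤ d ∧ HasLevel N i x := by
  simp only [h.hasLevel_of_iff]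
  exact ⟨fun hx => ⟨_, hx.1, hx.2, rfl⟩, fun ⟨i, h1, h2, h3⟩ => ⟨by rwa [h.graph_lev, h3],
    by rwa [h.graph_lev, h3]⟩⟩

theorem realize_pathF_band {α : Type} {s : α → K} {m : ℕ} {x y : α} {c d : ℤ} (hc : 0 ≤ c)
    (hd : d ≤ N) :
    (pathF N m x y (fun q => levelInF N c d (Sum.inr q))).Realize s ↔
      WalkIn h.graph.adj (h.graph.Band c d) m (.of (s x)) (.of (s y)) := by
  rw [h.walkIn_iff fun p hp => h.exists_of (hc.trans hp.1) (hp.2.trans hd), realize_pathF]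
  simp only [realize_levelInF, h.mem_band_iff, Sum.elim_inr]

/-- Lying beneath in the graph is expressed by the formula `beneathF`. -/
theorem realize_beneathF_of_lt {α : Type} {s : α → K} {a b : Vertex α}
    (hab : h.graph.Lt (a.eval s) (b.eval s)) : (beneathF N a b).Realize s := by
  have hlt := hab.lev_lt
  cases a with
  | bot =>
    cases b with
    | bot => simp [Vertex.eval] at hlt
    | var y => simp [beneathF]
    | top => simp [beneathF]
  | top =>
    have h1 := h.graph.lev_le (b.eval s)
    have h2 : h.graph.lev (Point.top : Point K) = N + 1 := rfl
    have h3 : h.graph.rank = N := rfl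
    simp only [Vertex.eval] at hlt h1
    omega
  | var x =>
    cases b with
    | bot =>
      have h1 := h.graph.neg_one_le_lev (.of (s x))
      have h2 : h.graph.lev (Point.bot : Point K) = -1 := rfl
      simp only [Vertex.eval] at hlt
      omega
    | top => simp [beneathF]
    | var y =>
      simp only [Vertex.eval] at hab hlt
      have hx := h.lev_of (s x)
      have hy := h.lev_of (s y)
      obtain ⟨b, hb⟩ := hab.exists_isPath
      rw [h.graph_lev] at hlt
      obtain ⟨l, hl⟩ : ∃ l : ℕ, h.lev (.of (s x)) = l := ⟨_, (Int.toNat_of_nonneg hx.1).symm⟩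
      obtain ⟨r, hr⟩ : ∃ r : ℕ, h.lev (.of (s y)) = r := ⟨_, (Int.toNat_of_nonneg hy.1).symm⟩
      simp only [beneathF, Formula.realize_iSup]
      refine ⟨⟨(⟨l, by omega⟩, ⟨r, by omega⟩), Fin.mk_lt_mk.2 (by omega)⟩, ?_⟩
      rw [realize_pathF]
      have hbl := hb.left
      have hbr := hb.right
      have hup := hb.up
      rw [h.graph_lev, hl] at hbl
      rw [h.graph_lev, hr] at hbr
      rw [h.graph_lev, hl, hr] at hup
      have hlev : ∀ j : Fin (r - l + 1), h.graph.lev (b (l + (j.val : ℕ))) = l + (j.val : ℕ) := by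
        intro j
        have := j.isLt
        exact hb.lev_eq (by rw [h.graph_lev]; omega) (by rw [h.graph_lev]; omega)
      choose z hz using fun j : Fin (r - l + 1) => h.exists_of (p := b (l + (j.val : ℕ)))
        (by rw [hlev j]; omega) (by rw [hlev j]; have := j.isLt; omega)
      refine ⟨z, ?_, ?_, fun j => ?_, fun j => ?_⟩
      · have := hz 0
        simp only [Fin.val_zero, Nat.cast_zero, add_zero, hbl] at this
        exact (Point.of.inj this).symm
      · have := hz (Fin.last _)
        rw [Fin.val_last, Nat.cast_sub (by omega), add_sub_cancel, hbr] at this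
        exact (Point.of.inj this).symm
      · have := (hup (l + (j.val : ℕ)) (by omega) (by have := j.isLt; simp only at this; omega)).1
        have h1 := hz j.castSucc
        have h2 := hz j.succ
        rw [Fin.val_castSucc] at h1
        rw [Fin.val_succ, Nat.cast_add, Nat.cast_one, ← add_assoc] at h2
        rw [h1, h2] at this
        exact this
      · rw [realize_levelF, h.hasLevel_iff]
        have := hlev j
        rw [hz j] at this
        exact this

/-- `beneathF` expresses lying beneath in the graph, if this relation satisfies the conventions for
the imaginary vertices. -/
theorem lt_of_realize_beneathF {α : Type} {s : α → K} {a b : Vertex α}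
    (hbot : ∀ p, p ≠ Point.bot → h.graph.Lt .bot p) (htop : ∀ p, p ≠ Point.top → h.graph.Lt p .top)
    (hab : (beneathF N a b).Realize s) : h.graph.Lt (a.eval s) (b.eval s) := by
  cases a with
  | bot =>
    cases b with
    | bot => exact absurd hab (by simp [beneathF])
    | var y => exact hbot _ (by simp [Vertex.eval])
    | top => exact hbot _ (by simp [Vertex.eval])
  | top => cases b <;> exact absurd hab (by simp [beneathF])
  | var x =>
    cases b with
    | bot => exact absurd hab (by simp [beneathF])
    | top => exact htop _ (by simp [Vertex.eval])
    | var y =>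
      simp only [beneathF, Formula.realize_iSup, realize_pathF] at hab
      obtain ⟨⟨⟨l, r⟩, hlr⟩, z, h0, h1, h2, h3⟩ := hab
      have hlr' : l.val < r.val := hlr
      simp only [realize_levelF, h.hasLevel_iff, Vertex.eval, Sum.elim_inr] at h3
      have := Relation.transGen_of_fin (r := h.graph.Up) (Nat.sub_pos_of_lt hlr') (fun j => Point.of (z j))
        fun j => ⟨h2 j, ?_⟩
      · simp only [h0, h1] at this
        exact this
      · have e1 := h3 j.castSucc
        have e2 := h3 j.succ
        rw [Fin.val_castSucc] at e1
        rw [Fin.val_succ] at e2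
        rw [h.graph_lev, e1, e2]
        push_cast
        ring

end IsColoredSpace

end Pseudospace

/-! ### From the axioms of `PS N` to simple connectedness of the graph. -/

namespace Pseudospace

open FirstOrder.Language FirstOrder.Language.Structure

/-- The matrix of the extension axiom: the variables `Sum.inr i` form a path from `a` to `b` whose
vertices have distance greater than `k` from the parameters. -/
noncomputable def extensionMatrix (N : ℕ) (l : ℤ) (w n k : ℕ) :
    (Pseudospace.language N).Formula ((Fin n ⊕ Fin 2) ⊕ Fin (w + 1)) :=
  Formula.iInf (fun i : Fin (w + 1) => levelF N (l + 1 + i.val) (.var (Sum.inr i))) ⊓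
  edgeF N ((vertexAt N l (Sum.inr 0 : Fin n ⊕ Fin 2)).map Sum.inl) (.var (Sum.inr 0)) ⊓
  Formula.iInf (fun i : Fin w =>
    edgeF N (.var (Sum.inr i.castSucc)) (.var (Sum.inr i.succ))) ⊓
  edgeF N (.var (Sum.inr (Fin.last w)))
    ((vertexAt N (l + w + 2) (Sum.inr 1 : Fin n ⊕ Fin 2)).map Sum.inl) ⊓
  Formula.iInf (fun i : Fin (w + 1) => Formula.iInf (fun j : Fin n =>
    ∼(Formula.iSup (fun m : Fin (k + 1) =>
      pathF N m (Sum.inr i) (Sum.inl (Sum.inl j))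
        (fun q => levelInF N (l + 1) (l + w + 2 - 1) (Sum.inr q))))))

theorem extensionAxiom_eq (N : ℕ) (l : ℤ) (w n k : ℕ) : extensionAxiom N l w n k = allF N
    (levelF N l (vertexAt N l (Sum.inr 0 : Fin n ⊕ Fin 2)) ⊓
      levelF N (l + w + 2) (vertexAt N (l + w + 2) (Sum.inr 1)) ⊓
      beneathF N (vertexAt N l (Sum.inr 0)) (vertexAt N (l + w + 2) (Sum.inr 1)) ⟹
      Formula.iExs (Fin (w + 1)) (extensionMatrix N l w n k)) := rfl

variable {N : ℕ} {K : Type w} [(Pseudospace.language N).Structure K]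

namespace IsColoredSpace

variable (h : IsColoredSpace N K)

theorem realize_extensionMatrix {l : ℤ} {w n k : ℕ} (hl : -1 ≤ l) (hr : l + w + 2 ≤ N + 1)
    {s : Fin n ⊕ Fin 2 → K} {z : Fin (w + 1) → K} {a b : Point K} (ha : h.graph.lev a = l)
    (hb : h.graph.lev b = l + w + 2) (has : ∀ y, a = .of y → s (.inr 0) = y)
    (hbs : ∀ y, b = .of y → s (.inr 1) = y) :
    (extensionMatrix N l w n k).Realize (Sum.elim s z) ↔
      (∀ i : Fin (w + 1), h.graph.lev (.of (z i)) = l + 1 + i.val) ∧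
      h.graph.adj a (.of (z 0)) ∧
      (∀ i : Fin w, h.graph.adj (.of (z i.castSucc)) (.of (z i.succ))) ∧
      h.graph.adj (.of (z (Fin.last w))) b ∧
      ∀ i j, ∀ m ≤ k, ¬ WalkIn h.graph.adj
        (h.graph.Band (h.graph.lev a + 1) (h.graph.lev b - 1)) m (.of (z i)) (.of (s (.inl j))) := by
  simp only [extensionMatrix, Formula.realize_inf, Formula.realize_iInf, realize_levelF,
    realize_edgeF, Formula.realize_not, Formula.realize_iSup, Vertex.eval_map, Sum.elim_comp_inl,
    h.realize_pathF_band (show 0 ≤ l + 1 by omega) (show l + w + 2 - 1 ≤ N by omega),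
    h.hasLevel_iff, eval_vertexAt h ha has, eval_vertexAt h hb hbs, Vertex.eval_var, Sum.elim_inr,
    Sum.elim_inl, and_assoc, ha, hb, ← h.graph_lev]
  refine and_congr Iff.rfl (and_congr Iff.rfl (and_congr Iff.rfl (and_congr Iff.rfl ?_)))
  refine forall_congr' fun i => forall_congr' fun j => ?_
  rw [not_exists]
  exact ⟨fun H m hm => H ⟨m, by omega⟩, fun H m => H m (by have := m.isLt; omega)⟩

/-- The realization of the extension axiom. -/
theorem exists_realize_extensionMatrix {l : ℤ} {w n k : ℕ} (hK : K ⊨ extensionAxiom N l w n k)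
    {s : Fin n ⊕ Fin 2 → K} {a b : Point K} (ha : h.graph.lev a = l)
    (hb : h.graph.lev b = l + w + 2) (has : ∀ y, a = .of y → s (.inr 0) = y)
    (hbs : ∀ y, b = .of y → s (.inr 1) = y)
    (hab : (beneathF N (vertexAt N l (Sum.inr 0))
      (vertexAt N (l + w + 2) (Sum.inr 1 : Fin n ⊕ Fin 2))).Realize s) :
    ∃ z, (extensionMatrix N l w n k).Realize (Sum.elim s z) := by
  rw [extensionAxiom_eq, realize_allF] at hK
  have := hK s
  simp only [Formula.realize_imp, Formula.realize_inf, Formula.realize_iExs, realize_levelF,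
    h.hasLevel_iff, eval_vertexAt h ha has, eval_vertexAt h hb hbs] at this
  exact this ⟨⟨ha, hb⟩, hab⟩

theorem exists_isPath {w : ℕ} {z : Fin (w + 1) → K} {a b : Point K}
    (hb : h.graph.lev b = h.graph.lev a + w + 2)
    (hz : ∀ i : Fin (w + 1), h.graph.lev (.of (z i)) = h.graph.lev a + 1 + i.val)
    (h0 : h.graph.adj a (.of (z 0)))
    (hs : ∀ i : Fin w, h.graph.adj (.of (z i.castSucc)) (.of (z i.succ)))
    (h1 : h.graph.adj (.of (z (Fin.last w))) b) :
    ∃ f, h.graph.IsPath a b f ∧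
      ∀ i, h.graph.lev a < i → i < h.graph.lev b → ∃ j, f i = .of (z j) := by
  let f : ℤ → Point K := fun i => if i ≤ h.graph.lev a then a else
    if hi : (i - h.graph.lev a - 1).toNat < w + 1 then .of (z ⟨_, hi⟩) else b
  have hfa : f (h.graph.lev a) = a := by simp [f]
  have hfb : f (h.graph.lev b) = b := by
    have e1 : ¬ h.graph.lev b ≤ h.graph.lev a := by omega
    have e2 : ¬ (h.graph.lev b - h.graph.lev a - 1).toNat < w + 1 := by omega
    simp only [f, e1, e2, if_false, dif_neg, not_false_eq_true]
  have hfz : ∀ j : Fin (w + 1), f (h.graph.lev a + 1 + j.val) = .of (z j) := by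
    intro j
    have e1 : ¬ h.graph.lev a + 1 + (j.val : ℤ) ≤ h.graph.lev a := by omega
    have e2 : (h.graph.lev a + 1 + (j.val : ℤ) - h.graph.lev a - 1).toNat = j.val := by omega
    simp only [f, e1, e2, if_false, j.isLt, dif_pos]
  have hlev : ∀ i, h.graph.lev a < i → i < h.graph.lev b →
      ∃ j : Fin (w + 1), i = h.graph.lev a + 1 + j.val := fun i hi hi' =>
    ⟨⟨(i - h.graph.lev a - 1).toNat, by omega⟩, by simp only; omega⟩
  refine ⟨f, ⟨hfa, hfb, fun i hi hi' => ?_⟩, fun i hi hi' => ?_⟩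
  · rcases hi.eq_or_lt with rfl | hi
    · have := hfz 0
      rw [Fin.val_zero, Nat.cast_zero, add_zero] at this
      rw [hfa, this]
      exact ⟨h0, by rw [hz 0]; simp⟩
    · obtain ⟨j, rfl⟩ := hlev i hi hi'
      rw [hfz j]
      rcases j.le_last.eq_or_lt with rfl | hj
      · have e : h.graph.lev a + 1 + ((Fin.last w).val : ℤ) + 1 = h.graph.lev b := by
          rw [Fin.val_last]; omega
        rw [e, hfb]
        exact ⟨h1, by rw [hz, e]⟩
      · obtain ⟨j, rfl⟩ : ∃ j' : Fin w, j = j'.castSucc := ⟨j.castLT hj, rfl⟩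
        have e : h.graph.lev a + 1 + (j.castSucc.val : ℤ) + 1 =
            h.graph.lev a + 1 + (j.succ.val : ℤ) := by
          rw [Fin.val_castSucc, Fin.val_succ]; push_cast; ring
        rw [e, hfz]
        exact ⟨hs j, by rw [hz, hz, e]⟩
  · obtain ⟨j, rfl⟩ := hlev i hi hi'
    exact ⟨j, hfz j⟩

end IsColoredSpace

theorem coloredSpace_of_PS (hK : K ⊨ PS N) : IsColoredSpace N K :=
  isColoredSpace (hK.mono fun _ h => .inl (.inl h))

theorem realize_extensionAxiom (hK : K ⊨ PS N) (l : ℤ) (w n k : ℕ) (hl : -1 ≤ l)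
    (hr : l + w + 2 ≤ N + 1) : K ⊨ extensionAxiom N l w n k :=
  hK.realize_of_mem _ (.inr ⟨l, w, n, k, hl, hr, rfl⟩)

/-- The formula `beneathF` holds for imaginary vertices by convention. The extension axiom without
parameters turns the convention into a genuine path. -/
theorem lt_of_extension [Nonempty K] (hK : K ⊨ PS N) (h : IsColoredSpace N K)
    {a b : Point K} (hab : h.graph.lev a + 2 ≤ h.graph.lev b) (hor : a = .bot ∨ b = .top) : h.graph.Lt a b := by
  obtain ⟨w, hw⟩ : ∃ w : ℕ, h.graph.lev b = h.graph.lev a + w + 2 :=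
    ⟨(h.graph.lev b - h.graph.lev a - 2).toNat, by omega⟩
  have hl := h.graph.neg_one_le_lev a
  have hr : h.graph.lev a + w + 2 ≤ N + 1 := hw ▸ h.graph.lev_le b
  -- The variable of an imaginary endpoint is never read, so any element can be its value.
  have hs : ∃ s : Fin 0 ⊕ Fin 2 → K, (∀ y, a = .of y → s (.inr 0) = y) ∧
      ∀ y, b = .of y → s (.inr 1) = y := by
    obtain ⟨x₀⟩ := ‹Nonempty K›
    cases a <;> cases b <;> simp only [Point.of.injEq, reduceCtorEq, false_imp_iff, implies_true,
      true_and, and_true, forall_eq']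
    · exact ⟨fun _ => x₀, trivial⟩
    · exact ⟨fun _ => _, rfl⟩
    · exact ⟨fun _ => x₀, trivial⟩
    · exact ⟨fun _ => _, rfl⟩
    · rename_i x y
      exact ⟨Sum.elim (fun i => i.elim0) ![x, y], rfl, rfl⟩
    · exact ⟨fun _ => _, rfl⟩
    · exact ⟨fun _ => x₀, trivial⟩
    · exact ⟨fun _ => _, rfl⟩
    · exact ⟨fun _ => x₀, trivial⟩
  obtain ⟨s, hsa, hsb⟩ := hs
  obtain ⟨z, hz⟩ := h.exists_realize_extensionMatrix
    (realize_extensionAxiom hK (h.graph.lev a) w 0 0 hl hr) rfl hw hsa hsb (by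
      have e1 := eval_vertexAt h (x := (Sum.inr 0 : Fin 0 ⊕ Fin 2)) rfl hsa
      have e2 := eval_vertexAt h (x := (Sum.inr 1 : Fin 0 ⊕ Fin 2)) rfl hsb
      rw [hw] at e2
      generalize vertexAt N (h.graph.lev a) (Sum.inr 0 : Fin 0 ⊕ Fin 2) = va at e1 ⊢
      generalize vertexAt N (h.graph.lev a + w + 2) (Sum.inr 1 : Fin 0 ⊕ Fin 2) = vb at e2 ⊢
      have hb : h.graph.lev .bot = -1 := rfl
      have ht : h.graph.lev .top = N + 1 := rfl
      have h3 := h.graph.lev_le b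
      have h4 : h.graph.rank = N := rfl
      rcases hor with rfl | rfl
      · cases va <;> simp only [Vertex.eval, reduceCtorEq] at e1
        cases vb <;> simp only [Vertex.eval] at e2
        · subst e2; omega
        · simp [beneathF]
        · simp [beneathF]
      · cases vb <;> simp only [Vertex.eval, reduceCtorEq] at e2
        cases va <;> simp only [Vertex.eval] at e1
        · simp [beneathF]
        · simp [beneathF]
        · subst e1; omega)
  rw [h.realize_extensionMatrix hl hr rfl hw hsa hsb] at hz
  obtain ⟨f, hf, -⟩ := h.exists_isPath hw hz.1 hz.2.1 hz.2.2.1 hz.2.2.2.1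
  have := hf.lt le_rfl (by omega) le_rfl
  rwa [hf.left, hf.right] at this

theorem simplyConnected [Nonempty K] (hK : K ⊨ PS N) (h : IsColoredSpace N K) :
    h.graph.SimplyConnected := by
  have hlb : h.graph.lev .bot = -1 := rfl
  have hlt : h.graph.lev .top = N + 1 := rfl
  have hbot : ∀ p, p ≠ Point.bot → h.graph.Lt .bot p := by
    intro p hp
    -- Between consecutive levels the extension axiom says nothing, but `bot` is linked to level `0`
    -- by definition.
    by_cases hp' : h.graph.lev p = 0
    · obtain ⟨x, rfl⟩ := h.exists_of hp'.ge (by omega)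
      exact .single ⟨h.hasLevel_of_iff.2 hp', by rw [hp', hlb]; rfl⟩
    · have h1 := h.graph.neg_one_le_lev p
      have h2 : h.graph.lev p ≠ -1 := fun h2 => hp (h.graph.eq_bot p h2)
      exact lt_of_extension hK h (by omega) (.inl rfl)
  have htop : ∀ p, p ≠ Point.top → h.graph.Lt p .top := by
    intro p hp
    by_cases hp' : h.graph.lev p = N
    · obtain ⟨x, rfl⟩ := h.exists_of (by omega) hp'.le
      exact .single ⟨h.hasLevel_of_iff.2 hp', by rw [hp', hlt]⟩
    · have h1 : h.graph.lev p ≤ N + 1 := h.graph.lev_le p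
      have h2 : h.graph.lev p ≠ N + 1 := fun h2 => hp (h.graph.eq_top p h2)
      exact lt_of_extension hK h (by omega) (.inr rfl)
  refine ⟨hbot, htop, ?_⟩
  intro a b x y i j hab hi hj hx hy hc
  have ha1 := h.graph.neg_one_le_lev a
  have hb1 : h.graph.lev b ≤ N + 1 := h.graph.lev_le b
  -- An imaginary vertex in the band can only be `a` or `b`, and both are excluded.
  have hS : ∀ p ∈ {z | z ∈ h.graph.Band i j ∧ z ≠ a ∧ z ≠ b}, ∃ x, p = .of x := by
    rintro p ⟨hp, hpa, hpb⟩
    cases p with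
    | bot =>
      have h1 := hp.1
      exact absurd (h.graph.eq_bot a (by omega)).symm hpa
    | of x => exact ⟨x, rfl⟩
    | top =>
      have h1 := hp.2
      exact absurd (h.graph.eq_top b (show _ = (N : ℤ) + 1 by omega)).symm hpb
  obtain ⟨x, rfl⟩ := hS x hc.left_mem
  obtain ⟨y, rfl⟩ := hS y hc.right_mem
  obtain ⟨k, hk⟩ := hc
  have hij := hk.left_mem.1.1.trans hk.left_mem.1.2
  rw [h.walkIn_iff hS] at hk
  obtain ⟨s, hsx, hsy, hsa, hsb⟩ : ∃ s : Fin 4 → K, s 2 = x ∧ s 3 = y ∧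
      (∀ u, a = .of u → s 0 = u) ∧ ∀ u, b = .of u → s 1 = u := by
    let d : Point K → K := fun p => Point.casesOn p x id x
    refine ⟨![d a, d b, x, y], rfl, rfl, ?_, ?_⟩
    · rintro u rfl; rfl
    · rintro u rfl; rfl
  subst hsx hsy
  have ea := eval_vertexAt h (x := (0 : Fin 4)) rfl hsa
  have eb := eval_vertexAt h (x := (1 : Fin 4)) rfl hsb
  have hax := hK.realize_of_mem _ (.inl (.inr ⟨h.graph.lev a, h.graph.lev b, i, j, k, ha1,
    hab.lev_lt, hb1, hi, hij, hj, rfl⟩))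
  rw [simplyConnectedAxiom, realize_allF] at hax
  have := hax s
  simp only [Formula.realize_imp, Formula.realize_inf] at this
  have := this ⟨⟨⟨⟨⟨by rw [realize_levelF, ea, h.hasLevel_iff]; rfl,
    by rw [realize_levelF, eb, h.hasLevel_iff]; rfl⟩,
    h.realize_beneathF_of_lt (by rwa [ea, eb])⟩,
    by
      rw [betweenF, Formula.realize_inf]
      exact ⟨h.realize_beneathF_of_lt (by rw [ea]; exact hx.1),
        h.realize_beneathF_of_lt (by rw [eb]; exact hx.2)⟩⟩,
    by
      rw [betweenF, Formula.realize_inf]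
      exact ⟨h.realize_beneathF_of_lt (by rw [ea]; exact hy.1),
        h.realize_beneathF_of_lt (by rw [eb]; exact hy.2)⟩⟩,
    by
      rw [realize_pathF]
      obtain ⟨z, h0, h1, h2, h3⟩ := hk
      refine ⟨z, h0, h1, h2, fun q => ?_⟩
      simp only [Formula.realize_inf, realize_levelInF, realize_neF, Vertex.eval_map,
        Sum.elim_comp_inl, Sum.elim_inr, ea, eb, ← h.mem_band_iff]
      exact ⟨⟨(h3 q).1, (h3 q).2.1⟩, (h3 q).2.2⟩⟩
  rw [Formula.realize_iSup] at this
  obtain ⟨m, hm⟩ := this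
  rw [realize_pathF] at hm
  refine ⟨m, (h.walkIn_iff fun p hp => ?_).2 ?_⟩
  · cases p with
    | bot => have := hp.2.1.lev_lt; omega
    | of x => exact ⟨x, rfl⟩
    | top => have := hp.2.2.lev_lt; omega
  · obtain ⟨z, h0, h1, h2, h3⟩ := hm
    refine ⟨z, h0, h1, h2, fun q => ?_⟩
    have hq := h3 q
    simp only [Formula.realize_inf, realize_levelInF, betweenF, Sum.elim_inr,
      ← h.mem_band_iff] at hq
    have q1 := h.lt_of_realize_beneathF hbot htop hq.2.1
    have q2 := h.lt_of_realize_beneathF hbot htop hq.2.2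
    rw [Vertex.eval_map, Sum.elim_comp_inl, ea] at q1
    rw [Vertex.eval_map, Sum.elim_comp_inl, eb] at q2
    exact ⟨hq.1, q1, q2⟩

end Pseudospace

/-! ### Countable saturation of the ultrapower. -/

/-- The ultrapower of `M` with respect to a nonprincipal ultrafilter on `ℕ`. -/
noncomputable def Ultrapower (M : Type w) : Type w := (Filter.hyperfilter ℕ : Filter ℕ).Product fun _ => M

namespace Ultrapower

open Filter

variable {L : FirstOrder.Language.{u, v}} {M : Type w}

/-- The class of a sequence in the ultrapower. -/
noncomputable def mk (f : ℕ → M) : Ultrapower M := (f : (hyperfilter ℕ : Filter ℕ).Product fun _ => M)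

theorem mk_surjective : Function.Surjective (mk (M := M)) :=
  fun x => Quotient.exists_rep x

noncomputable instance [L.Structure M] : L.Structure (Ultrapower M) :=
  inferInstanceAs <| L.Structure ((hyperfilter ℕ : Filter ℕ).Product fun _ => M)

instance [Nonempty M] : Nonempty (Ultrapower M) := ‹Nonempty M›.map fun x => mk fun _ => x

variable [L.Structure M] [Nonempty M]

theorem realize_iff {δ : Type*} (φ : L.Formula δ) (x : δ → ℕ → M) :
    (φ.Realize fun i => mk (x i)) ↔ ∀ᶠ t in (hyperfilter ℕ : Filter ℕ), φ.Realize fun i => x i t :=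
  FirstOrder.Language.Ultraproduct.realize_formula_cast φ x

theorem realize_const {δ : Type*} (φ : L.Formula δ) (x : δ → M) :
    (φ.Realize fun i => mk fun _ => x i) ↔ φ.Realize x := by
  rw [realize_iff]; exact eventually_const

theorem models (T : L.Theory) (h : M ⊨ T) : Ultrapower M ⊨ T := by
  refine ⟨fun φ hφ => ?_⟩
  have := (FirstOrder.Language.Ultraproduct.sentence_realize (M := fun _ : ℕ => M)
    (u := hyperfilter ℕ) φ).2 (Eventually.of_forall fun _ => h.realize_of_mem φ hφ)
  exact this

/-- The ultrapower realizes countable sets of formulas which are finitely satisfiable in it. -/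
theorem exists_forall_realize {γ β : Type*} (Φ : ℕ → L.Formula (γ ⊕ β)) (v : γ → Ultrapower M)
    (h : ∀ m, ∃ x : β → Ultrapower M, ∀ i ≤ m, (Φ i).Realize (Sum.elim v x)) :
    ∃ x : β → Ultrapower M, ∀ i, (Φ i).Realize (Sum.elim v x) := by
  classical
  obtain ⟨V, rfl⟩ : ∃ V : γ → ℕ → M, v = fun d => mk (V d) :=
    ⟨fun d => (mk_surjective (v d)).choose, funext fun d => (mk_surjective (v d)).choose_spec.symm⟩
  have helim : ∀ X : β → ℕ → M, (Sum.elim (fun d => mk (V d)) (fun d => mk (X d))) =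
      fun d => mk (Sum.elim V X d) := by
    intro X; funext d; cases d <;> rfl
  have helim' : ∀ (X : β → ℕ → M) (t : ℕ), (fun d => Sum.elim V X d t) =
      Sum.elim (fun d => V d t) (fun d => X d t) := by
    intro X t; funext d; cases d <;> rfl
  let P : ℕ → ℕ → Prop := fun t m =>
    ∃ x : β → M, ∀ i ≤ m, (Φ i).Realize (Sum.elim (fun d => V d t) x)
  have hP : ∀ m, ∀ᶠ t in (hyperfilter ℕ : Filter ℕ), P t m := by
    intro m
    obtain ⟨x, hx⟩ := h m
    obtain ⟨X, rfl⟩ : ∃ X : β → ℕ → M, x = fun d => mk (X d) :=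
      ⟨fun d => (mk_surjective (x d)).choose,
        funext fun d => (mk_surjective (x d)).choose_spec.symm⟩
    have : ∀ i ∈ Set.Iic m, ∀ᶠ t in (hyperfilter ℕ : Filter ℕ),
        (Φ i).Realize (Sum.elim (fun d => V d t) fun d => X d t) := by
      intro i hi
      have := hx i hi
      rw [helim, realize_iff] at this
      simpa only [helim'] using this
    exact ((Set.finite_Iic m).eventually_all.2 this).mono fun t ht => ⟨fun d => X d t, ht⟩
  -- Diagonal choice: coordinate `t` satisfies the longest possible initial segment of the formulas,
  -- up to index `t`. The cap makes the maximum exist; as almost all `t` are at least `i`, it does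
  -- not obstruct the `i`-th formula.
  have hx : ∀ t, ∃ x : β → M, P t (Nat.findGreatest (P t) t) →
      ∀ i ≤ Nat.findGreatest (P t) t, (Φ i).Realize (Sum.elim (fun d => V d t) x) := by
    intro t
    by_cases ht : P t (Nat.findGreatest (P t) t)
    · exact ⟨ht.choose, fun _ => ht.choose_spec⟩
    · exact ⟨fun _ => Classical.arbitrary M, fun h => absurd h ht⟩
  choose X hX using hx
  refine ⟨fun d => mk fun t => X t d, fun i => ?_⟩
  rw [helim (fun d t => X t d), realize_iff]
  simp only [helim' (fun d t => X t d)]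
  have hge : ∀ᶠ t in (hyperfilter ℕ : Filter ℕ), i ≤ t :=
    hyperfilter_le_cofinite (Nat.cofinite_eq_atTop ▸ eventually_ge_atTop i)
  filter_upwards [hP i, hge] with t h1 h2
  exact hX t (Nat.findGreatest_spec h2 h1) i (Nat.le_findGreatest h2 h1)

end Ultrapower

/-! ### Back-and-forth: isomorphisms of countable nice sets are elementary. -/

namespace Pseudospace

open FirstOrder.Language FirstOrder.Language.Structure

variable {N : ℕ} {K : Type w} [(Pseudospace.language N).Structure K]

/-- Isomorphisms between countable nice sets preserve all formulas. -/
theorem realize_iff_of_isIso (h : IsColoredSpace N K) (hG : h.graph.SimplyConnected)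
    (hR : h.graph.Rich) {α : Type*} {n : ℕ} (φ : (Pseudospace.language N).BoundedFormula α n)
    {D E : Set (Point K)} {g : Point K → Point K} (hD : h.graph.Nice D) (hE : h.graph.Nice E)
    (hEc : E.Countable) (hg : h.graph.IsIso D E g) {v v' : α → K} {xs xs' : Fin n → K}
    (hv : ∀ i, .of (v i) ∈ D ∧ g (.of (v i)) = .of (v' i))
    (hxs : ∀ i, .of (xs i) ∈ D ∧ g (.of (xs i)) = .of (xs' i)) :
    φ.Realize v xs ↔ φ.Realize v' xs' := by
  -- The language has no function symbols, so terms are variables.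
  have hterm : ∀ {n : ℕ} {xs xs' : Fin n → K} {D : Set (Point K)} {g : Point K → Point K},
      (∀ i, .of (v i) ∈ D ∧ g (.of (v i)) = .of (v' i)) →
      (∀ i, .of (xs i) ∈ D ∧ g (.of (xs i)) = .of (xs' i)) →
      ∀ t : (Pseudospace.language N).Term (α ⊕ Fin n), .of (t.realize (Sum.elim v xs)) ∈ D ∧
        g (.of (t.realize (Sum.elim v xs))) = .of (t.realize (Sum.elim v' xs')) := by
    intro n xs xs' D g hv hxs t
    cases t with
    | var i =>
      cases i with
      | inl i => exact hv i
      | inr i => exact hxs i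
    | func f _ => exact f.elim
  induction φ generalizing D E g with
  | falsum => exact Iff.rfl
  | equal t₁ t₂ =>
    have h1 := hterm hv hxs t₁
    have h2 := hterm hv hxs t₂
    simp only [BoundedFormula.Realize]
    rw [← Point.of.injEq, ← Point.of.injEq (t₁.realize (Sum.elim v' xs')), ← h1.2, ← h2.2,
      hg.bijOn.injOn.eq_iff h1.1 h2.1]
  | @rel n l R ts =>
    have ht := fun i => hterm hv hxs (ts i)
    simp only [BoundedFormula.Realize]
    cases R with
    | level i =>
      have key : ∀ y : Fin 1 → K, RelMap (L := Pseudospace.language N) (Rel.level i) y ↔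
          h.graph.lev (.of (y 0)) = i.val := by
        intro y
        rw [h.graph_lev, ← h.hasLevel_of_iff]
        have hy : y = ![y 0] := by funext j; fin_cases j; rfl
        have hi : (⟨((i.val : ℤ)).toNat, by omega⟩ : Fin (N + 1)) = i := by
          apply Fin.ext; simp
        constructor
        · intro hy'
          refine ⟨⟨by omega, by omega⟩, ?_⟩
          rw [hi, ← hy]; exact hy'
        · rintro ⟨_, hy'⟩
          rw [hi, ← hy] at hy'; exact hy'
      rw [key, key, ← (ht 0).2, hg.lev_eq _ (ht 0).1]
    | edge =>
      have key : ∀ y : Fin 2 → K, RelMap (L := Pseudospace.language N) Rel.edge y ↔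
          h.graph.adj (.of (y 0)) (.of (y 1)) := by
        intro y
        have hy : y = ![y 0, y 1] := by funext j; fin_cases j <;> rfl
        rw [h.graph_adj_of, Linked, ← hy]; rfl
      rw [key, key, ← (ht 0).2, ← (ht 1).2, hg.adj_iff _ (ht 0).1 _ (ht 1).1]
  | imp φ ψ ihφ ihψ =>
    simp only [BoundedFormula.realize_imp]
    exact imp_congr (ihφ hD hE hEc hg hv hxs) (ihψ hD hE hEc hg hv hxs)
  | @all n φ ih =>
    have snoc : ∀ {D : Set (Point K)} {g : Point K → Point K} {x x' : K},
        (∀ i, .of (xs i) ∈ D ∧ g (.of (xs i)) = .of (xs' i)) → .of x ∈ D → g (.of x) = .of x' →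
        ∀ i, .of (Fin.snoc (α := fun _ => K) xs x i) ∈ D ∧
          g (.of (Fin.snoc (α := fun _ => K) xs x i)) =
            .of (Fin.snoc (α := fun _ => K) xs' x' i) := by
      intro D g x x' hxs hx hx' i
      induction i using Fin.lastCases with
      | last => simpa using ⟨hx, hx'⟩
      | cast i => simpa using hxs i
    have img : ∀ {D E : Set (Point K)} {g : Point K → Point K}, h.graph.IsIso D E g → ∀ x : K,
        .of x ∈ D → ∃ x', g (.of x) = .of x' := by
      intro D E g hg x hx
      have h1 := h.lev_of x
      have h2 := hg.lev_eq _ hx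
      rw [h.graph_lev] at h2
      exact h.exists_of (by rw [h.graph_lev, h2]; exact h1.1) (by rw [h.graph_lev, h2]; exact h1.2)
    simp only [BoundedFormula.realize_all]
    constructor
    · intro H x'
      -- The "back" direction: extend the inverse isomorphism to `x'`, then invert again.
      obtain ⟨g', hg', hinv⟩ := hg.symm
      obtain ⟨E₁, D₁, g₁, hE₁, hD₁, hD₁c, hg₁, heq, hsub, hx'⟩ :=
        hR.exists_isIso_mem hG hE hD (hg.countable hEc) hg' (.of x')
      obtain ⟨x, hx⟩ := img hg₁ x' hx'
      obtain ⟨g₂, hg₂, hinv₂⟩ := hg₁.symm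
      have hval : ∀ {y y' : K}, .of y ∈ D → g (.of y) = .of y' →
          .of y ∈ D₁ ∧ g₂ (.of y) = .of y' := by
        intro y y' hy hyy'
        have h1 : Point.of y' ∈ E := hyy' ▸ hg.bijOn.mapsTo hy
        have h2 : g₁ (.of y') = .of y := by rw [heq h1, ← hyy', hinv _ hy]
        exact ⟨h2 ▸ hg₁.bijOn.mapsTo (hsub h1), by rw [← h2, hinv₂ _ (hsub h1)]⟩
      have hxs₂ := fun i => hval (hxs i).1 (hxs i).2
      exact (ih hD₁ hE₁ (hg₁.countable hD₁c) hg₂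
        (fun i => hval (hv i).1 (hv i).2) (snoc hxs₂ (hx ▸ hg₁.bijOn.mapsTo hx')
          (by rw [← hx, hinv₂ _ hx']))).1 (H x)
    · intro H x
      obtain ⟨D₁, E₁, g₁, hD₁, hE₁, hE₁c, hg₁, heq, hsub, hx⟩ :=
        hR.exists_isIso_mem hG hD hE hEc hg (.of x)
      obtain ⟨x', hx'⟩ := img hg₁ x hx
      have hxs₁ : ∀ i, .of (xs i) ∈ D₁ ∧ g₁ (.of (xs i)) = .of (xs' i) := fun i =>
        ⟨hsub (hxs i).1, by rw [heq (hxs i).1, (hxs i).2]⟩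
      exact (ih hD₁ hE₁ hE₁c hg₁ (fun i => ⟨hsub (hv i).1, by rw [heq (hv i).1, (hv i).2]⟩)
        (snoc hxs₁ hx hx')).2 (H x')

end Pseudospace

/-! ### Realizing types in the ultrapower, richness, and the count of types. -/

open FirstOrder.Language in
/-- A complete type over a set `A` of parameters is finitely satisfiable. -/
theorem FirstOrder.Language.Theory.CompleteType.exists_forall_realize_iff
    {L : FirstOrder.Language.{u, v}} {M : Type w} [L.Structure M] [Nonempty M] {A : Set M} {n : ℕ}
    (p : (L[[A]].completeTheory M).CompleteType (Fin n)) {ι : Type*} [Finite ι]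
    (φ : ι → L[[A]].Formula (Fin n)) :
    ∃ x : Fin n → M, ∀ i, (φ i).Realize x ↔ Formula.equivSentence (φ i) ∈ p := by
  classical
  obtain ⟨M', x', hx'⟩ :=
    FirstOrder.Language.Theory.exists_modelType_is_realized_in _ p
  have hiff : ∀ i, (φ i).Realize x' ↔ Formula.equivSentence (φ i) ∈ p := by
    intro i
    rw [← hx', Theory.CompleteType.formula_mem_typeOf]
  let ψ : ι → L[[A]].Formula (Fin n) := fun i =>
    if Formula.equivSentence (φ i) ∈ p then φ i else (φ i).not
  have hψ : ∀ {M₁ : Type _} [L[[A]].Structure M₁] (x : Fin n → M₁) i, (ψ i).Realize x ↔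
      ((φ i).Realize x ↔ Formula.equivSentence (φ i) ∈ p) := by
    intro M₁ _ x i
    by_cases h : Formula.equivSentence (φ i) ∈ p <;> simp [ψ, h, Formula.realize_not]
  have hψ' : ∀ (x : Fin n → M) i, (ψ i).Realize x ↔
      ((φ i).Realize x ↔ Formula.equivSentence (φ i) ∈ p) := by
    intro x i
    by_cases h : Formula.equivSentence (φ i) ∈ p <;> simp [ψ, h, Formula.realize_not]
  -- If `σ` failed in `M`, its negation would belong to the complete theory and hold in `M'`, where
  -- `x'` satisfies the formulas.
  let σ : L[[A]].Sentence := Formula.iExs (Fin n) ((Formula.iInf ψ).relabel Sum.inr)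
  have hM' : M' ⊨ σ := by
    simp only [σ, Sentence.Realize, Formula.realize_iExs, Formula.realize_relabel,
      Sum.elim_comp_inr, Formula.realize_iInf]
    exact ⟨x', fun i => (hψ x' i).2 (hiff i)⟩
  have hM : M ⊨ σ := by
    by_contra hσ
    have h1 : M' ⊨ σ.not := M'.is_model.realize_of_mem _ hσ
    exact h1 hM'
  simp only [σ, Sentence.Realize, Formula.realize_iExs, Formula.realize_relabel,
    Sum.elim_comp_inr, Formula.realize_iInf] at hM
  obtain ⟨x, hx⟩ := hM
  exact ⟨x, fun i => (hψ' x i).1 (hx i)⟩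

open FirstOrder.Language in
/-- Complete types over a countable set of parameters are realized in the ultrapower. -/
theorem Ultrapower.exists_realize_iff_mem {L : FirstOrder.Language.{u, v}} [Countable L.Symbols]
    {M : Type w} [L.Structure M] [Nonempty M] {A : Set M} (hA : A.Countable) {n : ℕ}
    (p : (L[[A]].completeTheory M).CompleteType (Fin n)) :
    ∃ x : Fin n → Ultrapower M, ∀ φ : L[[A]].Formula (Fin n),
      Formula.Realize (BoundedFormula.constantsVarsEquiv φ)
        (Sum.elim (fun a : A => Ultrapower.mk fun _ => (a : M)) x) ↔
        Formula.equivSentence φ ∈ p := by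
  classical
  have : Countable A := hA.to_subtype
  obtain ⟨f, hf⟩ := exists_surjective_nat (L[[A]].Formula (Fin n))
  let Φ : ℕ → L.Formula (A ⊕ Fin n) := fun i =>
    if Formula.equivSentence (f i) ∈ p then BoundedFormula.constantsVarsEquiv (f i)
    else Formula.not (BoundedFormula.constantsVarsEquiv (f i))
  have hΦ : ∀ i (x : A ⊕ Fin n → Ultrapower M), (Φ i).Realize x ↔
      (Formula.Realize (BoundedFormula.constantsVarsEquiv (f i)) x ↔
        Formula.equivSentence (f i) ∈ p) := by
    intro i x
    by_cases h : Formula.equivSentence (f i) ∈ p <;> simp [Φ, h, Formula.realize_not]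
  obtain ⟨x, hx⟩ := Ultrapower.exists_forall_realize Φ
    (fun a : A => Ultrapower.mk fun _ => (a : M)) (by
      intro m
      obtain ⟨x, hx⟩ := p.exists_forall_realize_iff fun i : Fin (m + 1) => f i
      refine ⟨fun i => Ultrapower.mk fun _ => x i, fun i hi => ?_⟩
      rw [hΦ, ← hx ⟨i, by omega⟩]
      have h1 : Sum.elim (fun a : A => Ultrapower.mk fun _ => (a : M))
          (fun i => Ultrapower.mk fun _ => x i) =
          fun j => Ultrapower.mk fun _ => Sum.elim (fun a : A => (a : M)) x j := by
        funext j; cases j <;> rfl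
      rw [h1, Ultrapower.realize_const]
      exact BoundedFormula.realize_constantsVarsEquiv (M := M) (φ := f i) (v := x)
        (xs := default))
  refine ⟨x, fun φ => ?_⟩
  obtain ⟨i, rfl⟩ := hf φ
  exact (hΦ i _).1 (hx i)

namespace Pseudospace

open FirstOrder.Language FirstOrder.Language.Structure

instance (N : ℕ) : Countable (Pseudospace.language N).Symbols := by
  have h1 : Countable (Σ l, (Pseudospace.language N).Functions l) :=
    ⟨fun x => x.2.elim, fun x => x.2.elim⟩
  have h2 : Countable (Σ l, (Pseudospace.language N).Relations l) := by
    refine Function.Surjective.countable (α := Option (Fin (N + 1))) (f := fun o =>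
      o.elim ⟨2, Rel.edge⟩ fun i => ⟨1, Rel.level i⟩) ?_
    rintro ⟨_, R⟩
    cases R with
    | level i => exact ⟨some i, rfl⟩
    | edge => exact ⟨none, rfl⟩
  exact inferInstanceAs (Countable (_ ⊕ _))

variable {N : ℕ} {M : Type w} [(Pseudospace.language N).Structure M] [Nonempty M]

/-- The extension axioms give, for each `m`, a path at distance greater than `m` from the first `m`
parameters. These conditions grow stronger with `m`, and saturation realizes all of them at once. -/
theorem rich_ultrapower (hM : Ultrapower M ⊨ PS N) (h : IsColoredSpace N (Ultrapower M)) :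
    h.graph.Rich := by
  intro A hA a c hac hgap
  obtain ⟨w, hw⟩ : ∃ w : ℕ, h.graph.lev c = h.graph.lev a + w + 2 :=
    ⟨(h.graph.lev c - h.graph.lev a - 2).toNat, by omega⟩
  have hl := h.graph.neg_one_le_lev a
  have hr : h.graph.lev a + w + 2 ≤ N + 1 := hw ▸ h.graph.lev_le c
  obtain ⟨x₀⟩ : Nonempty (Ultrapower M) := inferInstance
  -- The extra element makes the set nonempty, so that it can be enumerated by `ℕ`.
  have hAc : (insert x₀ (Point.of ⁻¹' A)).Countable :=
    (hA.preimage_of_injOn fun x _ y _ hxy => Point.of.inj hxy).insert x₀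
  obtain ⟨f, hf⟩ := hAc.exists_eq_range (Set.insert_nonempty _ _)
  let d : Point (Ultrapower M) → Ultrapower M := fun p => Point.casesOn p x₀ id x₀
  have hda : ∀ y, a = .of y → ![d a, d c] 0 = y := by rintro y rfl; rfl
  have hdc : ∀ y, c = .of y → ![d a, d c] 1 = y := by rintro y rfl; rfl
  let s : ℕ ⊕ Fin 2 → Ultrapower M := Sum.elim f ![d a, d c]
  let Φ : ℕ → (Pseudospace.language N).Formula ((ℕ ⊕ Fin 2) ⊕ Fin (w + 1)) := fun m =>
    (extensionMatrix N (h.graph.lev a) w m m).relabel (Sum.map (Sum.map Fin.val id) id)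
  have hΦ : ∀ m (z : Fin (w + 1) → Ultrapower M), (Φ m).Realize (Sum.elim s z) ↔
      (extensionMatrix N (h.graph.lev a) w m m).Realize
        (Sum.elim (Sum.elim (fun i : Fin m => f i) ![d a, d c]) z) := by
    intro m z
    rw [Formula.realize_relabel]
    have : Sum.elim s z ∘ Sum.map (Sum.map Fin.val id) id =
        Sum.elim (Sum.elim (fun i : Fin m => f i) ![d a, d c]) z := by
      funext j
      rcases j with (j | j) | j <;> rfl
    rw [this]
  obtain ⟨z, hz⟩ := Ultrapower.exists_forall_realize Φ s (by
    intro m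
    obtain ⟨z, hz⟩ := h.exists_realize_extensionMatrix
      (realize_extensionAxiom hM (h.graph.lev a) w m m hl hr)
      (s := Sum.elim (fun i : Fin m => f i) ![d a, d c]) rfl hw hda hdc
      (h.realize_beneathF_of_lt (by
        rwa [eval_vertexAt (s := Sum.elim (fun i : Fin m => f i) ![d a, d c]) (x := Sum.inr 0)
            h rfl hda,
          eval_vertexAt (s := Sum.elim (fun i : Fin m => f i) ![d a, d c]) (x := Sum.inr 1)
            h hw hdc]))
    refine ⟨z, fun i hi => ?_⟩
    rw [h.realize_extensionMatrix hl hr rfl hw hda hdc] at hz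
    rw [hΦ, h.realize_extensionMatrix hl hr rfl hw hda hdc]
    exact ⟨hz.1, hz.2.1, hz.2.2.1, hz.2.2.2.1, fun q j m' hm' =>
      hz.2.2.2.2 q (j.castLE hi) m' (hm'.trans hi)⟩)
  have hz' := fun m => (h.realize_extensionMatrix hl hr rfl hw hda hdc).1 ((hΦ m z).1 (hz m))
  obtain ⟨b, hb, hbz⟩ := h.exists_isPath hw (hz' 0).1 (hz' 0).2.1 (hz' 0).2.2.1 (hz' 0).2.2.2.1
  refine ⟨b, hb, fun i hi hi' e he hc => ?_⟩
  obtain ⟨j, hj⟩ := hbz i hi hi'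
  have heB := hc.right_mem
  have h1 := heB.1
  have h2 := heB.2
  obtain ⟨x, rfl⟩ := h.exists_of (p := e) (by omega) (by omega)
  obtain ⟨q, hq⟩ : x ∈ Set.range f := hf ▸ Set.mem_insert_of_mem _ he
  obtain ⟨m, hm⟩ := hc
  rw [hj, ← hq] at hm
  -- The index must exceed `q` for `f q` to be among the parameters, and be at least the length `m`
  -- of the forbidden walk.
  exact (hz' (max (q + 1) m)).2.2.2.2 j ⟨q, by omega⟩ m (le_max_right _ _) hm

end Pseudospace

open FirstOrder.Language in
theorem proposition7p6 (N : ℕ) (hN : 1 ≤ N) : (Pseudospace.PS N).IsOmegaStable := by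
  intro M _ _ hM A hA n
  have hK := Ultrapower.models (Pseudospace.PS N) hM
  have h := Pseudospace.coloredSpace_of_PS hK
  have hG := Pseudospace.simplyConnected hK h
  have hR := Pseudospace.rich_ultrapower hK h
  let c : A → Ultrapower M := fun a => Ultrapower.mk fun _ => (a : M)
  have : Countable A := hA.to_subtype
  obtain ⟨W, hW, hiso⟩ :=
    hR.exists_countable_isIso hG (Set.countable_range fun a => Pseudospace.Point.of (c a))
  have hW' : Countable (Pseudospace.Point.of ⁻¹' W) :=
    (hW.preimage_of_injOn fun x _ y _ hxy => Pseudospace.Point.of.inj hxy).to_subtype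
  have key : ∀ p : ((Pseudospace.language N)[[A]].completeTheory M).CompleteType (Fin n),
      ∃ x : Fin n → (Pseudospace.Point.of ⁻¹' W),
        ∀ φ : (Pseudospace.language N)[[A]].Formula (Fin n),
          Formula.Realize (BoundedFormula.constantsVarsEquiv φ)
            (Sum.elim c fun i => (x i : Ultrapower M)) ↔ Formula.equivSentence φ ∈ p := by
    intro p
    obtain ⟨x, hx⟩ := Ultrapower.exists_realize_iff_mem hA p
    -- The realization is moved into the countable set `W` by an isomorphism fixing `A`, which
    -- preserves its type.
    obtain ⟨D, E, g, hD, hE, hEc, hg, hAD, hgA, hxD, hxW⟩ := hiso n fun i => .of (x i)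
    have hof : ∀ i, ∃ y, g (.of (x i)) = .of y := fun i => by
      have h1 := h.lev_of (x i)
      have h2 := hg.lev_eq _ (hxD i)
      rw [h.graph_lev] at h2
      exact h.exists_of (by rw [h.graph_lev, h2]; exact h1.1) (by rw [h.graph_lev, h2]; exact h1.2)
    choose y hy using hof
    refine ⟨fun i => ⟨y i, by rw [Set.mem_preimage, ← hy]; exact hxW i⟩, fun φ => ?_⟩
    rw [← hx φ]
    refine (Pseudospace.realize_iff_of_isIso h hG hR _ hD hE hEc hg ?_ fun i => i.elim0).symm
    rintro (a | i)
    · exact ⟨hAD ⟨a, rfl⟩, hgA _ ⟨a, rfl⟩⟩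
    · exact ⟨hxD i, hy i⟩
  choose F hF using key
  -- A type is determined by any tuple realizing it, and there are countably many `n`-tuples from
  -- `W`.
  refine Function.Injective.countable (f := F) fun p q hpq => SetLike.ext fun σ => ?_
  rw [← Formula.equivSentence.apply_symm_apply σ, ← hF p, ← hF q, hpq]
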